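/- Let $m\ge 1$ and $s\ge 2$ be integers. Let the group $(\mathbb{Z}_2)^{s-1}$, with generators $\sigma_1,\dots,\sigma_{s-1}$, act on $(S^m)^{s}$ by letting $\sigma_i$ change the sign of the $i$-th coordinate, let $P_{\mathbf{m}_s}$ be the quotient of $(S^m)^{s}$ by the involution $(x_1,\dots,x_s)\mapsto(-x_1,\dots,-x_s)$, with the induced $(\mathbb{Z}_2)^{s-1}$-action, and let $\pi_s\colon P_{\mathbf{m}_s}\to(\mathbb{RP}^m)^{s}$ be the map induced by the $s$-fold power of the double cover $S^m\to\mathbb{RP}^m$. Let $\xi_m$ be the Hopf (tautological) real line bundle over $\mathbb{RP}^m$, and let $p_i\colon(\mathbb{RP}^m)^s\to\mathbb{RP}^m$ be the $i$-th projection ($1\le i\le s$). Then $\pi_s$ is a principal $(\mathbb{Z}_2)^{s-1}$-bundle, and there is a map $(\mathbb{RP}^m)^s\to(\mathbb{RP}^\infty)^{s-1}$ classifying it, that is, a continuous map along which the universal bundle $(S^\infty)^{s-1}\to(\mathbb{RP}^\infty)^{s-1}$ pulls back to a principal bundle isomorphic to $\pi_s$. Moreover, for every map $\mu_s\colon(\mathbb{RP}^m)^s\to(\mathbb{RP}^\infty)^{s-1}$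 that classifies $\pi_s$ and every $1\le i\le s-1$, the $i$-th component $\mu_{i,s}\colon(\mathbb{RP}^m)^s\to\mathbb{RP}^\infty$ of $\mu_s$ has the following properties. 1. $\mu_{i,s}$ classifies the line bundle $p_i^*(\xi_m)\otimes p_s^*(\xi_m)$: the pullback along $\mu_{i,s}$ of the tautological line bundle over $\mathbb{RP}^\infty$ is isomorphic to $p_i^*(\xi_m)\otimes p_s^*(\xi_m)$. 2. $\mu_{i,s}$ is homotopic to the composition of the projection $(p_i,p_s)\colon(\mathbb{RP}^m)^s\to\mathbb{RP}^m\times\mathbb{RP}^m$, the inclusion $\mathbb{RP}^m\times\mathbb{RP}^m\hookrightarrow\mathbb{RP}^\infty\times\mathbb{RP}^\infty$, and the Hopf multiplication $\mu\colon\mathbb{RP}^\infty\times\mathbb{RP}^\infty\to\mathbb{RP}^\infty$ (induced by multiplication of nonzero real polynomials, when $\mathbb{RP}^\infty$ is regarded as the space of nonzero real polynomials up to scalars). -/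

import Mathlib

open Topology Set Polynomial Bundle TensorProduct
noncomputable section ProjectiveProduct

/-- The orbit relation of the involution `x ↦ -x`. -/
def antipodalSetoid (X : Type*) [InvolutiveNeg X] : Setoid X where
  r x y := y = x ∨ y = -x
  iseqv :=
    { refl := fun _ => Or.inl rfl
      symm := by
        rintro x y (rfl | rfl)
        · exact Or.inl rfl
        · exact Or.inr (neg_neg x).symm
      trans := by
        rintro x y z (rfl | rfl) (rfl | rfl)
        · exact Or.inl rfl
        · exact Or.inr rfl
        · exact Or.inr rfl
        · exact Or.inl (neg_neg x) }

/-- The orbit space of `X` under the involution `x ↦ -x`, with the quotient topology. -/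
abbrev AntipodalQuotient (X : Type*) [InvolutiveNeg X] : Type _ := Quotient (antipodalSetoid X)

namespace AntipodalQuotient
variable {X : Type*} [InvolutiveNeg X]

def mk (x : X) : AntipodalQuotient X := Quotient.mk (antipodalSetoid X) x

theorem mk_eq_mk {x y : X} : mk x = mk y ↔ y = x ∨ y = -x := Quotient.eq

theorem mk_neg (x : X) : mk (-x) = mk x := mk_eq_mk.2 (Or.inr (neg_neg x).symm)

theorem isOpenQuotientMap_mk [TopologicalSpace X] [ContinuousNeg X] :
    IsOpenQuotientMap (mk : X → AntipodalQuotient X) where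
  surjective := Quotient.mk_surjective
  continuous := continuous_quotient_mk'
  isOpenMap U hU := by
    have h : (mk : X → AntipodalQuotient X) ⁻¹' (mk '' U) = U ∪ Neg.neg ⁻¹' U := by
      ext y
      constructor
      · rintro ⟨x, hx, h⟩
        rcases mk_eq_mk.1 h with rfl | rfl
        · exact Or.inl hx
        · exact Or.inr (by simpa using hx)
      · rintro (h | h)
        · exact ⟨y, h, rfl⟩
        · exact ⟨-y, h, mk_neg y⟩
    change IsOpen ((mk : X → AntipodalQuotient X) ⁻¹' (mk '' U))
    rw [h]
    exact hU.union (hU.preimage continuous_neg)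
end AntipodalQuotient

/-- The vector space `ℝ^∞` of finitely supported real sequences; a sequence `(a₀, a₁, …)` is
written as the polynomial `∑ aₖ Xᵏ`. -/
abbrev RInf : Type := ℝ[X]

namespace RInf

/-- The inclusion `ℝⁿ → ℝ^∞`, `(v₀, …, vₙ₋₁) ↦ (v₀, …, vₙ₋₁, 0, 0, …)`. -/
def ofVec (n : ℕ) (v : Fin n → ℝ) : RInf := ∑ i : Fin n, monomial (i : ℕ) (v i)

/-- The colimit topology: a set is open iff its intersection with every `ℝⁿ` is open. -/
instance : TopologicalSpace RInf :=
  ⨆ n : ℕ, TopologicalSpace.coinduced (ofVec n) inferInstance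

theorem coeff_ofVec {n : ℕ} (v : Fin n → ℝ) (k : ℕ) :
    (ofVec n v).coeff k = if h : k < n then v ⟨k, h⟩ else 0 := by
  simp only [ofVec, finsetSum_coeff, coeff_monomial]
  split_ifs with h
  · rw [Finset.sum_eq_single ⟨k, h⟩]
    · simp
    · intro b _ hb
      rw [if_neg]
      intro h'
      exact hb (Fin.ext h')
    · simp
  · refine Finset.sum_eq_zero fun i _ => if_neg ?_
    have := i.2
    omega

theorem continuous_ofVec (n : ℕ) : Continuous (ofVec n) :=
  continuous_iff_coinduced_le.2
    (le_iSup (fun n : ℕ => TopologicalSpace.coinduced (ofVec n) inferInstance) n)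

theorem continuous_dom {Y : Type*} [TopologicalSpace Y] {f : RInf → Y}
    (h : ∀ n, Continuous fun v : Fin n → ℝ => f (ofVec n v)) : Continuous f :=
  continuous_iSup_dom.2 fun n => continuous_coinduced_dom.2 (h n)

theorem isOpen_of {U : Set RInf} (h : ∀ n, IsOpen (ofVec n ⁻¹' U)) : IsOpen U :=
  isOpen_iSup_iff.2 fun n => isOpen_coinduced.2 (h n)

theorem ofVec_coeff {f : RInf} {n : ℕ} (h : ∀ k, n ≤ k → f.coeff k = 0) :
    ofVec n (fun i => f.coeff i) = f := by
  ext k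
  rw [coeff_ofVec]
  split_ifs with hk
  · rfl
  · exact (h k (not_lt.1 hk)).symm

theorem continuous_of_bounded {Y : Type*} [TopologicalSpace Y] {f : Y → RInf} (n : ℕ)
    (hn : ∀ y k, n ≤ k → (f y).coeff k = 0) (hf : ∀ k, Continuous fun y => (f y).coeff k) :
    Continuous f := by
  have : f = fun y => ofVec n (fun i => (f y).coeff i) :=
    funext fun y => (ofVec_coeff (hn y)).symm
  rw [this]
  exact (continuous_ofVec n).comp (continuous_pi fun i => hf i)

theorem continuous_coeff (k : ℕ) : Continuous fun f : RInf => f.coeff k := by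
  refine continuous_dom fun n => ?_
  simp only [coeff_ofVec]
  split_ifs
  · exact continuous_apply _
  · exact continuous_const

theorem coeff_bounded (f : RInf) : ∃ n, ∀ k, n ≤ k → f.coeff k = 0 :=
  ⟨f.natDegree + 1, fun _ hk => coeff_eq_zero_of_natDegree_lt hk⟩

theorem continuous_const_add (f : RInf) : Continuous fun g : RInf => f + g := by
  obtain ⟨N, hN⟩ := coeff_bounded f
  refine continuous_dom fun n => continuous_of_bounded (max n N) (fun v k hk => ?_) fun k => ?_
  · rw [coeff_add, hN k (le_trans (le_max_right _ _) hk), coeff_ofVec,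
      dif_neg (not_lt.2 (le_trans (le_max_left _ _) hk)), add_zero]
  · simp only [coeff_add]
    exact continuous_const.add ((continuous_coeff k).comp (continuous_ofVec n))

theorem continuous_const_mul (f : RInf) : Continuous fun g : RInf => f * g := by
  obtain ⟨N, hN⟩ := coeff_bounded f
  refine continuous_dom fun n => continuous_of_bounded (n + N) (fun v k hk => ?_) fun k => ?_
  · rw [coeff_mul]
    refine Finset.sum_eq_zero fun p hp => ?_
    have := Finset.HasAntidiagonal.mem_antidiagonal.1 hp
    rcases le_or_gt N p.1 with h | h
    · rw [hN _ h, zero_mul]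
    · rw [coeff_ofVec, dif_neg (by omega), mul_zero]
  · simp only [coeff_mul]
    exact continuous_finsetSum _ fun p _ =>
      continuous_const.mul ((continuous_coeff p.2).comp (continuous_ofVec n))

theorem isOpen_box (ε : ℕ → ℝ) (hε : ∀ k, 0 < ε k) :
    IsOpen {g : RInf | ∀ k, |g.coeff k| < ε k} := by
  refine isOpen_of fun n => ?_
  have : ofVec n ⁻¹' {g : RInf | ∀ k, |g.coeff k| < ε k} =
      ⋂ i : Fin n, {v : Fin n → ℝ | |v i| < ε i} := by
    ext v
    simp only [mem_preimage, mem_ofPred_eq, mem_iInter, coeff_ofVec]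
    constructor
    · intro h i
      simpa using h i
    · intro h k
      split_ifs with hk
      · exact h ⟨k, hk⟩
      · simpa using hε k
  rw [this]
  exact isOpen_iInter_of_finite fun i =>
    isOpen_lt (continuous_abs.comp (continuous_apply i)) continuous_const

theorem exists_box_step {U : Set RInf} (hU : IsOpen U) (n : ℕ) (e : ℕ → ℝ)
    (he : ∀ k, 0 < e k)
    (h : ∀ g : RInf, (∀ k, n ≤ k → g.coeff k = 0) → (∀ k, k < n → |g.coeff k| ≤ e k) → g ∈ U) :
    ∃ e' : ℕ → ℝ, (∀ k, 0 < e' k) ∧ (∀ k, k < n → e' k = e k) ∧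
      ∀ g : RInf, (∀ k, n + 1 ≤ k → g.coeff k = 0) →
        (∀ k, k < n + 1 → |g.coeff k| ≤ e' k) → g ∈ U := by
  let K : Set (Fin n → ℝ) := Set.pi univ fun i => Icc (-e i) (e i)
  have hK : IsCompact K := isCompact_univ_pi fun i => isCompact_Icc
  let F : (Fin n → ℝ) × ℝ → RInf := fun p => ofVec n p.1 + monomial n p.2
  have hF : Continuous F := by
    refine continuous_of_bounded (n + 1) (fun p k hk => ?_) fun k => ?_
    · rw [coeff_add, coeff_ofVec, dif_neg (by omega), coeff_monomial, if_neg (by omega), add_zero]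
    · simp only [F, coeff_add, coeff_monomial]
      refine ((continuous_coeff k).comp ((continuous_ofVec n).comp continuous_fst)).add ?_
      split_ifs
      · exact continuous_snd
      · exact continuous_const
  have hsub : K ×ˢ {(0 : ℝ)} ⊆ F ⁻¹' U := by
    rintro ⟨v, t⟩ ⟨hv, ht⟩
    have ht : t = 0 := ht
    subst ht
    have hv0 : F (v, 0) = ofVec n v := by simp [F]
    rw [mem_preimage, hv0]
    refine h _ (fun k hk => ?_) fun k hk => ?_
    · rw [coeff_ofVec, dif_neg (not_lt.2 hk)]
    · rw [coeff_ofVec, dif_pos hk]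
      exact abs_le.2 (hv ⟨k, hk⟩ (mem_univ _))
  obtain ⟨u, w, -, hw, hKu, h0w, huw⟩ :=
    generalized_tube_lemma hK isCompact_singleton (hU.preimage hF) hsub
  obtain ⟨δ, hδ, hδw⟩ := Metric.isOpen_iff.1 hw 0 (h0w rfl)
  refine ⟨fun k => if k < n then e k else δ / 2, fun k => ?_, fun k hk => if_pos hk,
    fun g hg hg' => ?_⟩
  · dsimp only
    split_ifs
    · exact he k
    · positivity
  · have : g = F (fun i => g.coeff i, g.coeff n) := by
      ext k
      simp only [F, coeff_add, coeff_ofVec, coeff_monomial]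
      rcases lt_trichotomy k n with hk | hk | hk
      · simp [hk, hk.ne']
      · simp [hk]
      · simp [hk.not_gt, hk.ne, hg k hk]
    rw [this]
    refine huw ⟨hKu fun i _ => abs_le.1 ?_, hδw ?_⟩
    · have := hg' i (by have := i.2; omega)
      simpa using this
    · have := hg' n (by omega)
      simp only [lt_irrefl, if_false] at this
      rw [Metric.mem_ball, Real.dist_eq, sub_zero]
      linarith

theorem exists_box {U : Set RInf} (hU : IsOpen U) (h0 : (0 : RInf) ∈ U) :
    ∃ ε : ℕ → ℝ, (∀ k, 0 < ε k) ∧ ∀ g : RInf, (∀ k, |g.coeff k| ≤ ε k) → g ∈ U := by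
  let Q : ℕ → Type := fun n => {e : ℕ → ℝ // (∀ k, 0 < e k) ∧ ∀ g : RInf,
    (∀ k, n ≤ k → g.coeff k = 0) → (∀ k, k < n → |g.coeff k| ≤ e k) → g ∈ U}
  have q0 : Q 0 := ⟨fun _ => 1, fun _ => one_pos, fun g hg _ => by
    have : g = 0 := by
      ext k
      simpa using hg k (Nat.zero_le k)
    rwa [this]⟩
  have hstep : ∀ n (e : Q n), ∃ e' : Q (n + 1), ∀ k, k < n → e'.1 k = e.1 k := fun n e => by
    obtain ⟨e', h1, h2, h3⟩ := exists_box_step hU n e.1 e.2.1 e.2.2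
    exact ⟨⟨e', h1, h3⟩, h2⟩
  choose st hst using hstep
  let E : ∀ n, Q n := fun n => Nat.rec q0 st n
  have hE : ∀ k n, k < n → (E n).1 k = (E (k + 1)).1 k := by
    intro k n hn
    induction n, hn using Nat.le_induction with
    | base => rfl
    | succ n hn ih => rw [← ih]; exact hst n (E n) k hn
  refine ⟨fun k => (E (k + 1)).1 k, fun k => (E (k + 1)).2.1 k, fun g hg => ?_⟩
  obtain ⟨n, hn⟩ := coeff_bounded g
  refine (E n).2.2 g hn fun k hk => ?_
  rw [hE k n hk]
  exact hg k

theorem box_mem_nhds (ε : ℕ → ℝ) (hε : ∀ k, 0 < ε k) :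
    {g : RInf | ∀ k, |g.coeff k| < ε k} ∈ 𝓝 (0 : RInf) :=
  (isOpen_box ε hε).mem_nhds (by simpa using hε)

theorem exists_box_nhds {U : Set RInf} (hU : U ∈ 𝓝 (0 : RInf)) :
    ∃ ε : ℕ → ℝ, (∀ k, 0 < ε k) ∧ ∀ g : RInf, (∀ k, |g.coeff k| ≤ ε k) → g ∈ U := by
  obtain ⟨W, hW, hWo, h0⟩ := mem_nhds_iff.1 hU
  obtain ⟨ε, h1, h2⟩ := exists_box hWo h0
  exact ⟨ε, h1, fun g hg => hW (h2 g hg)⟩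

instance : IsTopologicalAddGroup RInf := by
  refine IsTopologicalAddGroup.of_comm_of_nhds_zero ?_ ?_ ?_
  · intro U hU
    obtain ⟨ε, h1, h2⟩ := exists_box_nhds hU
    have h3 := box_mem_nhds (fun k => ε k / 2) (fun k => half_pos (h1 k))
    rw [Filter.mem_map]
    filter_upwards [Filter.prod_mem_prod h3 h3] with p hp
    refine h2 _ fun k => ?_
    have h4 := hp.1 k
    have h5 := hp.2 k
    change |(p.1 + p.2).coeff k| ≤ ε k
    rw [coeff_add]
    exact (abs_add_le _ _).trans (by linarith)
  · intro U hU
    obtain ⟨ε, h1, h2⟩ := exists_box_nhds hU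
    rw [Filter.mem_map]
    filter_upwards [box_mem_nhds ε h1] with g hg
    exact h2 _ fun k => by rw [coeff_neg, abs_neg]; exact (hg k).le
  · intro f
    have h1 : Continuous fun g : RInf => f + g := continuous_const_add f
    have h2 : Continuous fun g : RInf => -f + g := continuous_const_add (-f)
    let H : RInf ≃ₜ RInf :=
      { toFun := fun g => f + g
        invFun := fun g => -f + g
        left_inv := fun g => by simp
        right_inv := fun g => by simp
        continuous_toFun := h1
        continuous_invFun := h2 }
    have := H.map_nhds_eq 0
    simp only [H, Homeomorph.homeomorph_mk_coe, Equiv.coe_fn_mk, add_zero] at this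
    exact this.symm

theorem tendsto_mul_zero :
    Filter.Tendsto (Function.uncurry ((· * ·) : RInf → RInf → RInf))
      (𝓝 0 ×ˢ 𝓝 0) (𝓝 (0 : RInf)) := by
  intro U hU
  obtain ⟨ε, h1, h2⟩ := exists_box_nhds hU
  -- for `i + j = k` one of `i`, `j` is at least `k / 2`
  have hδ : ∀ i : ℕ, ∃ δ : ℝ, 0 < δ ∧ δ ≤ 1 ∧ ∀ k, k ≤ 2 * i → δ ≤ ε k / (k + 1) := by
    intro i
    have : ∀ n : ℕ, ∃ δ : ℝ, 0 < δ ∧ δ ≤ 1 ∧ ∀ k, k ≤ n → δ ≤ ε k / (k + 1) := by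
      intro n
      induction n with
      | zero =>
        refine ⟨min 1 (ε 0), lt_min one_pos (h1 0), min_le_left _ _, fun k hk => ?_⟩
        obtain rfl : k = 0 := by omega
        simp
      | succ n ih =>
        obtain ⟨δ, h3, h4, h5⟩ := ih
        have h6 : 0 < ε (n + 1) / ((n + 1 : ℕ) + 1) := div_pos (h1 _) (by positivity)
        refine ⟨min δ (ε (n + 1) / ((n + 1 : ℕ) + 1)), lt_min h3 h6,
          (min_le_left _ _).trans h4, fun k hk => ?_⟩
        rcases Nat.lt_or_ge n k with h | h
        · obtain rfl : k = n + 1 := by omega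
          exact min_le_right _ _
        · exact (min_le_left _ _).trans (h5 k h)
    exact this (2 * i)
  choose δ hδ0 hδ1 hδ2 using hδ
  have h3 := box_mem_nhds δ hδ0
  rw [Filter.mem_map]
  filter_upwards [Filter.prod_mem_prod h3 h3] with p hp
  refine h2 _ fun k => ?_
  have hk : (0 : ℝ) < k + 1 := by positivity
  change |(p.1 * p.2).coeff k| ≤ ε k
  rw [coeff_mul]
  refine (Finset.abs_sum_le_sum_abs _ _).trans ?_
  have : ∀ q ∈ Finset.HasAntidiagonal.antidiagonal k, |p.1.coeff q.1 * p.2.coeff q.2| ≤ ε k / (k + 1) := by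
    intro q hq
    have hq := Finset.HasAntidiagonal.mem_antidiagonal.1 hq
    have h4 := (hp.1 q.1).le
    have h5 := (hp.2 q.2).le
    rw [abs_mul]
    rcases le_total q.1 q.2 with h | h
    · have h6 := hδ2 q.2 k (by omega)
      have h7 := h4.trans (hδ1 q.1)
      nlinarith [abs_nonneg (p.1.coeff q.1), abs_nonneg (p.2.coeff q.2)]
    · have h6 := hδ2 q.1 k (by omega)
      have h7 := h5.trans (hδ1 q.2)
      nlinarith [abs_nonneg (p.1.coeff q.1), abs_nonneg (p.2.coeff q.2)]
  refine (Finset.sum_le_sum this).trans ?_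
  rw [Finset.sum_const, Finset.Nat.card_antidiagonal, nsmul_eq_mul]
  push_cast
  exact (mul_div_cancel₀ _ hk.ne').le

instance : IsTopologicalRing RInf := by
  refine IsTopologicalRing.of_addGroup_of_nhds_zero tendsto_mul_zero (fun f => ?_) (fun f => ?_)
  · simpa using (continuous_const_mul f).tendsto 0
  · simpa [mul_comm] using (continuous_const_mul f).tendsto 0

instance : ContinuousSMul ℝ RInf where
  continuous_smul := by
    have hC : Continuous fun c : ℝ => (C c : RInf) := by
      refine continuous_of_bounded 1 (fun c k hk => ?_) fun k => ?_
      · rw [coeff_C, if_neg (by omega)]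
      · simp only [coeff_C]
        split_ifs
        · exact continuous_id
        · exact continuous_const
    simp only [smul_eq_C_mul]
    exact (hC.comp continuous_fst).mul continuous_snd

instance : SeparatingDual ℝ RInf where
  exists_ne_zero' f hf := by
    obtain ⟨k, hk⟩ : ∃ k, f.coeff k ≠ 0 := by
      by_contra! h
      exact hf (by ext k; simpa using h k)
    exact ⟨⟨lcoeff ℝ k, continuous_coeff k⟩, hk⟩

/-- The squared Euclidean norm `∑ aₖ²`. -/
def normSq (f : RInf) : ℝ := f.sum fun _ a => a ^ 2

theorem normSq_eq_of_bounded {f : RInf} {n : ℕ} (h : ∀ k, n ≤ k → f.coeff k = 0) :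
    normSq f = ∑ k ∈ Finset.range n, f.coeff k ^ 2 := by
  refine sum_eq_of_subset (fun _ a => a ^ 2) (fun _ => by simp) fun k hk => ?_
  rw [Finset.mem_range]
  by_contra h'
  exact mem_support_iff.1 hk (h k (not_lt.1 h'))

theorem continuous_normSq : Continuous normSq := by
  refine continuous_dom fun n => ?_
  have : (fun v : Fin n → ℝ => normSq (ofVec n v)) =
      fun v => ∑ k ∈ Finset.range n, (ofVec n v).coeff k ^ 2 :=
    funext fun v => normSq_eq_of_bounded fun k hk => by rw [coeff_ofVec, dif_neg (not_lt.2 hk)]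
  rw [this]
  exact continuous_finsetSum _ fun k _ =>
    ((continuous_coeff k).comp (continuous_ofVec n)).pow 2

theorem normSq_ofVec {n : ℕ} (v : Fin n → ℝ) : normSq (ofVec n v) = ∑ i, v i ^ 2 := by
  rw [normSq_eq_of_bounded (n := n) fun k hk => by rw [coeff_ofVec, dif_neg (not_lt.2 hk)],
    Finset.sum_range]
  simp [coeff_ofVec]

theorem normSq_smul (c : ℝ) (f : RInf) : normSq (c • f) = c ^ 2 * normSq f := by
  obtain ⟨n, hn⟩ := coeff_bounded f
  rw [normSq_eq_of_bounded hn, normSq_eq_of_bounded (f := c • f) (n := n)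
    fun k hk => by rw [coeff_smul, hn k hk, smul_zero], Finset.mul_sum]
  simp [mul_pow]

theorem normSq_neg (f : RInf) : normSq (-f) = normSq f := by
  simpa using normSq_smul (-1) f

theorem normSq_pos {f : RInf} (hf : f ≠ 0) : 0 < normSq f := by
  refine Finset.sum_pos (fun k hk => ?_) (nonempty_support_iff.2 hf)
  have := mem_support_iff.1 hk
  positivity

theorem ofVec_neg {n : ℕ} (v : Fin n → ℝ) : ofVec n (-v) = -ofVec n v := by
  simp [ofVec]

end RInf

/-- The sphere `S^m`. -/
abbrev RealSphere (m : ℕ) : Set (EuclideanSpace ℝ (Fin (m + 1))) := Metric.sphere 0 1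

/-- The sphere `S^∞ ⊆ ℝ^∞`. -/
def InfSphere : Set RInf := {f | RInf.normSq f = 1}

instance : InvolutiveNeg InfSphere where
  neg f := ⟨-f.1, (RInf.normSq_neg f.1).trans f.2⟩
  neg_neg f := Subtype.ext (neg_neg f.1)

instance : ContinuousNeg InfSphere where
  continuous_neg := (continuous_neg.comp continuous_subtype_val).subtype_mk _

/-- Real projective space `RP^m = S^m / ±1`. -/
abbrev RP (m : ℕ) : Type := AntipodalQuotient (RealSphere m)

/-- Infinite real projective space `RP^∞ = S^∞ / ±1`. -/
abbrev RPInf : Type := AntipodalQuotient InfSphere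

def sphereInclusion (m : ℕ) (x : RealSphere m) : InfSphere :=
  ⟨RInf.ofVec (m + 1) fun i => x.1 i, by
    have h := EuclideanSpace.norm_sq_eq x.1
    rw [norm_eq_of_mem_sphere x] at h
    change RInf.normSq _ = 1
    rw [RInf.normSq_ofVec]
    simpa using h.symm⟩

theorem continuous_sphereInclusion (m : ℕ) : Continuous (sphereInclusion m) :=
  ((RInf.continuous_ofVec (m + 1)).comp (by fun_prop)).subtype_mk _

theorem sphereInclusion_neg (m : ℕ) (x : RealSphere m) :
    sphereInclusion m (-x) = -sphereInclusion m x :=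
  Subtype.ext (RInf.ofVec_neg fun i => x.1 i)

/-- The standard inclusion `RP^m → RP^∞`. -/
def rpInclusion (m : ℕ) : C(RP m, RPInf) where
  toFun := Quotient.lift (fun x => AntipodalQuotient.mk (sphereInclusion m x)) <| by
    rintro x y (rfl | rfl)
    · rfl
    · rw [sphereInclusion_neg, AntipodalQuotient.mk_neg]
  continuous_toFun :=
    (AntipodalQuotient.isOpenQuotientMap_mk.continuous.comp
      (continuous_sphereInclusion m)).quotient_lift _

theorem InfSphere.ne_zero (f : InfSphere) : f.1 ≠ 0 := by
  intro h
  have h1 : RInf.normSq f.1 = 1 := f.2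
  rw [h] at h1
  simp [RInf.normSq] at h1

/-- Multiplication of polynomials followed by normalization, `S^∞ × S^∞ → S^∞`. -/
def sphereMul (f g : InfSphere) : InfSphere :=
  ⟨(√(RInf.normSq (f.1 * g.1)))⁻¹ • (f.1 * g.1), by
    have h := RInf.normSq_pos (mul_ne_zero (InfSphere.ne_zero f) (InfSphere.ne_zero g))
    change RInf.normSq _ = 1
    rw [RInf.normSq_smul, inv_pow, Real.sq_sqrt h.le, inv_mul_cancel₀ h.ne']⟩

theorem sphereMul_neg_left (f g : InfSphere) : sphereMul (-f) g = -sphereMul f g := by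
  refine Subtype.ext ?_
  change (√(RInf.normSq (-f.1 * g.1)))⁻¹ • (-f.1 * g.1) =
    -((√(RInf.normSq (f.1 * g.1)))⁻¹ • (f.1 * g.1))
  rw [neg_mul, RInf.normSq_neg, smul_neg]

theorem sphereMul_neg_right (f g : InfSphere) : sphereMul f (-g) = -sphereMul f g := by
  refine Subtype.ext ?_
  change (√(RInf.normSq (f.1 * -g.1)))⁻¹ • (f.1 * -g.1) =
    -((√(RInf.normSq (f.1 * g.1)))⁻¹ • (f.1 * g.1))
  rw [mul_neg, RInf.normSq_neg, smul_neg]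

theorem continuous_sphereMul : Continuous fun p : InfSphere × InfSphere => sphereMul p.1 p.2 := by
  have h : Continuous fun p : InfSphere × InfSphere => p.1.1 * p.2.1 :=
    (continuous_subtype_val.comp continuous_fst).mul (continuous_subtype_val.comp continuous_snd)
  have h' : Continuous fun p : InfSphere × InfSphere => √(RInf.normSq (p.1.1 * p.2.1)) :=
    Real.continuous_sqrt.comp (RInf.continuous_normSq.comp h)
  refine Continuous.subtype_mk (Continuous.smul (h'.inv₀ fun p => ?_) h) _
  exact (Real.sqrt_pos.2 (RInf.normSq_pos (mul_ne_zero (InfSphere.ne_zero p.1) (InfSphere.ne_zero p.2)))).ne'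

/-- The Hopf multiplication `RP^∞ × RP^∞ → RP^∞`: if a point of `RP^∞` is regarded as a nonzero
polynomial up to scalars, it is multiplication of polynomials, with strict unit `[1]`. -/
def hopfMul : C(RPInf × RPInf, RPInf) where
  toFun p := Quotient.map₂ sphereMul
    (by
      rintro x x' (rfl | rfl) y y' (rfl | rfl)
      · exact Or.inl rfl
      · exact Or.inr (sphereMul_neg_right _ _)
      · exact Or.inr (sphereMul_neg_left _ _)
      · exact Or.inl (by rw [sphereMul_neg_left, sphereMul_neg_right, neg_neg]))
    p.1 p.2
  continuous_toFun := by
    have hq := AntipodalQuotient.isOpenQuotientMap_mk (X := InfSphere)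
    rw [(hq.prodMap hq).isQuotientMap.continuous_iff]
    exact hq.continuous.comp continuous_sphereMul

section SignAction

variable (X : Type*) [InvolutiveNeg X]

/-- `{1, -1}` acts by `1 • x = x`, `(-1) • x = -x`. -/
abbrev signMulAction : MulAction ℤˣ X where
  smul u x := if u = 1 then x else -x
  one_smul x := if_pos rfl
  mul_smul u v x := by
    change (if u * v = 1 then x else -x) =
      if u = 1 then (if v = 1 then x else -x) else -(if v = 1 then x else -x)
    rcases Int.units_eq_one_or u with rfl | rfl <;> rcases Int.units_eq_one_or v with rfl | rfl <;>
      simp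

end SignAction

instance (m : ℕ) : MulAction ℤˣ (RealSphere m) := signMulAction _

instance : MulAction ℤˣ InfSphere := signMulAction _

theorem RealSphere.smul_neg {m : ℕ} (u : ℤˣ) (x : RealSphere m) : u • (-x) = -(u • x) := by
  change (if u = 1 then -x else - -x) = -(if u = 1 then x else -x)
  split_ifs <;> rfl

/-- The group `(ℤ₂)^(s-1)`, with `ℤ₂` written as `{1, -1}`. -/
abbrev SignGroup (s : ℕ) : Type := Fin (s - 1) → ℤˣ

/-- The projective product space: `(S^m)^s` modulo `(x₁, …, xₛ) ↦ (-x₁, …, -xₛ)`. -/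
abbrev ProjProd (m s : ℕ) : Type := AntipodalQuotient (Fin s → RealSphere m)

/-- `(g₁, …, gₛ₋₁)` sends `(x₁, …, xₛ)` to `(g₁ x₁, …, gₛ₋₁ xₛ₋₁, xₛ)`. -/
def flipSigns {m s : ℕ} (g : SignGroup s) (x : Fin s → RealSphere m) : Fin s → RealSphere m :=
  fun j => if h : (j : ℕ) < s - 1 then g ⟨j, h⟩ • x j else x j

/-- The action of `(ℤ₂)^(s-1)` on the projective product space induced by `flipSigns`. -/
instance (m s : ℕ) : MulAction (SignGroup s) (ProjProd m s) where
  smul g := Quotient.map (flipSigns g) <| by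
    rintro x y (rfl | rfl)
    · exact Or.inl rfl
    · refine Or.inr (funext fun j => ?_)
      simp only [flipSigns, Pi.neg_apply]
      split_ifs
      · exact RealSphere.smul_neg _ _
      · rfl
  one_smul p := by
    induction p using Quotient.inductionOn with | _ x
    refine congrArg (Quotient.mk _) (funext fun j => ?_)
    simp [flipSigns]
  mul_smul g h p := by
    induction p using Quotient.inductionOn with | _ x
    refine congrArg (Quotient.mk _) (funext fun j => ?_)
    simp only [flipSigns]
    split_ifs
    · exact mul_smul _ _ _
    · rfl

/-- The projection `πₛ`, induced by the `s`-fold power of `S^m → RP^m`. -/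
def piProj (m s : ℕ) : C(ProjProd m s, Fin s → RP m) where
  toFun := Quotient.lift (fun x j => AntipodalQuotient.mk (x j)) <| by
    rintro x y (rfl | rfl)
    · rfl
    · exact funext fun j => (AntipodalQuotient.mk_neg (x j)).symm
  continuous_toFun := Continuous.quotient_lift (continuous_pi fun j =>
    AntipodalQuotient.isOpenQuotientMap_mk.continuous.comp (continuous_apply j)) _

/-- The universal `(ℤ₂)^r`-principal bundle `(S^∞)^r → (RP^∞)^r` (its total space is contractible);
the group `Fin r → ℤˣ` acts on the total space componentwise. -/
def univProj (r : ℕ) : C(Fin r → InfSphere, Fin r → RPInf) where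
  toFun y i := AntipodalQuotient.mk (y i)
  continuous_toFun := continuous_pi fun i =>
    AntipodalQuotient.isOpenQuotientMap_mk.continuous.comp (continuous_apply i)

/-- `proj : P → B` is a (locally trivial) principal `G`-bundle. -/
structure IsPrincipalBundle (G : Type*) [Group G] [TopologicalSpace G] {P B : Type*}
    [TopologicalSpace P] [TopologicalSpace B] [MulAction G P] (proj : C(P, B)) : Prop where
  proj_smul : ∀ (g : G) (p : P), proj (g • p) = proj p
  locally_trivial : ∀ b : B, ∃ U : Set B, IsOpen U ∧ b ∈ U ∧
    ∃ φ : (proj ⁻¹' U) ≃ₜ U × G,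
      (∀ p, ((φ p).1 : B) = proj p.1) ∧
      ∀ (g : G) (p q : proj ⁻¹' U), q.1 = g • p.1 → (φ q).2 = g * (φ p).2

/-- `f : B → BG` classifies the principal `G`-bundle `proj : P → B` with respect to the universal
bundle `q : E → BG`: the bundle is isomorphic, over `B` and `G`-equivariantly, to the pullback of
`q` along `f`. -/
def ClassifiesPrincipal (G : Type*) [Group G] {P B E BG : Type*} [TopologicalSpace P]
    [TopologicalSpace B] [TopologicalSpace E] [TopologicalSpace BG] [MulAction G P]
    [MulAction G E] (q : C(E, BG)) (f : C(B, BG)) (proj : C(P, B)) : Prop :=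
  ∃ Φ : P ≃ₜ {z : B × E // f z.1 = q z.2},
    (∀ p, (Φ p).1.1 = proj p) ∧ ∀ (g : G) (p : P), (Φ (g • p)).1.2 = g • (Φ p).1.2

section TautologicalBundle

/-- The involution of `S ⊆ V ∖ {0}` is the restriction of `v ↦ -v`. -/
class AntipodalIn {V : Type*} [AddCommGroup V] (S : Set V) [InvolutiveNeg S] : Prop where
  coe_neg : ∀ x : S, ((-x : S) : V) = -(x : V)
  coe_ne_zero : ∀ x : S, (x : V) ≠ 0

instance (m : ℕ) : AntipodalIn (RealSphere m) where
  coe_neg _ := rfl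
  coe_ne_zero x := ne_zero_of_mem_unit_sphere x

instance : AntipodalIn InfSphere where
  coe_neg _ := rfl
  coe_ne_zero := InfSphere.ne_zero

variable {V : Type*} [AddCommGroup V] [Module ℝ V] (S : Set V) [InvolutiveNeg S] [AntipodalIn S]

/-- The line `ℝ x` of a point `[x]` of `S / ±1`. -/
def tautLine : AntipodalQuotient S → Submodule ℝ V :=
  Quotient.lift (fun x : S => Submodule.span ℝ {(x : V)}) <| by
    rintro x y (rfl | rfl)
    · rfl
    · rw [AntipodalIn.coe_neg, ← Set.neg_singleton, Submodule.span_neg]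

/-- The tautological line bundle over `S / ±1`: its fibre over `[x]` is the line `ℝ x`. -/
def Taut (b : AntipodalQuotient S) : Type _ := tautLine S b

instance (b : AntipodalQuotient S) : AddCommGroup (Taut S b) :=
  inferInstanceAs (AddCommGroup (tautLine S b))

instance (b : AntipodalQuotient S) : Module ℝ (Taut S b) :=
  inferInstanceAs (Module ℝ (tautLine S b))

def tautIncl (b : AntipodalQuotient S) : Taut S b →ₗ[ℝ] V := (tautLine S b).subtype

variable [TopologicalSpace V]

instance (b : AntipodalQuotient S) : TopologicalSpace (Taut S b) :=
  inferInstanceAs (TopologicalSpace (tautLine S b))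

/-- The total space `{([x], v) | v ∈ ℝ x}` is topologized as a subspace of `(S / ±1) × V`. -/
instance : TopologicalSpace (TotalSpace ℝ (Taut S)) :=
  TopologicalSpace.induced (fun p => (p.1, tautIncl S p.1 p.2)) inferInstance

theorem isInducing_taut : IsInducing
    (fun p : TotalSpace ℝ (Taut S) => ((p.1, tautIncl S p.1 p.2) : AntipodalQuotient S × V)) :=
  ⟨rfl⟩

def tautDomain (φ : V →L[ℝ] ℝ) : Set (AntipodalQuotient S) :=
  {b | ∃ v : Taut S b, φ (tautIncl S b v) ≠ 0}

variable {S}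

theorem mk_mem_tautDomain {φ : V →L[ℝ] ℝ} {x : S} :
    AntipodalQuotient.mk x ∈ tautDomain S φ ↔ φ x ≠ 0 := by
  constructor
  · rintro ⟨⟨v, hv⟩, h⟩ hx
    obtain ⟨a, rfl⟩ := Submodule.mem_span_singleton.1 hv
    apply h
    change φ (a • (x : V)) = 0
    rw [map_smul, hx, smul_zero]
  · intro h
    exact ⟨⟨x, Submodule.mem_span_singleton_self _⟩, h⟩

def tautSection (φ : V →L[ℝ] ℝ) : AntipodalQuotient S → V :=
  Quotient.lift (fun x : S => (φ x)⁻¹ • (x : V)) <| by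
    rintro x y (rfl | rfl)
    · rfl
    · simp [AntipodalIn.coe_neg, inv_neg]

theorem tautSection_mem (φ : V →L[ℝ] ℝ) (b : AntipodalQuotient S) :
    tautSection φ b ∈ tautLine S b := by
  induction b using Quotient.inductionOn with | _ x
  exact Submodule.smul_mem _ _ (Submodule.mem_span_singleton_self _)

theorem apply_tautSection {φ : V →L[ℝ] ℝ} {b : AntipodalQuotient S} (hb : b ∈ tautDomain S φ) :
    φ (tautSection φ b) = 1 := by
  induction b using Quotient.inductionOn with | _ x
  have h : φ x ≠ 0 := mk_mem_tautDomain.1 hb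
  change φ ((φ x)⁻¹ • (x : V)) = 1
  rw [map_smul, smul_eq_mul, inv_mul_cancel₀ h]

theorem smul_tautSection {φ : V →L[ℝ] ℝ} {b : AntipodalQuotient S} (hb : b ∈ tautDomain S φ)
    (v : Taut S b) : φ (tautIncl S b v) • tautSection φ b = tautIncl S b v := by
  induction b using Quotient.inductionOn with | _ x
  have h : φ x ≠ 0 := mk_mem_tautDomain.1 hb
  obtain ⟨v, hv⟩ := v
  obtain ⟨a, rfl⟩ := Submodule.mem_span_singleton.1 hv
  change φ (a • (x : V)) • ((φ x)⁻¹ • (x : V)) = a • (x : V)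
  rw [map_smul, smul_eq_mul, smul_smul, mul_assoc, mul_inv_cancel₀ h, mul_one]

theorem exists_mem_tautDomain [SeparatingDual ℝ V] (b : AntipodalQuotient S) :
    ∃ φ : V →L[ℝ] ℝ, b ∈ tautDomain S φ := by
  induction b using Quotient.inductionOn with | _ x
  obtain ⟨φ, hφ⟩ := SeparatingDual.exists_ne_zero (R := ℝ) (AntipodalIn.coe_ne_zero x)
  exact ⟨φ, mk_mem_tautDomain.2 hφ⟩

variable [ContinuousNeg S]

theorem isOpen_tautDomain (φ : V →L[ℝ] ℝ) : IsOpen (tautDomain S φ) := by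
  rw [← (AntipodalQuotient.isOpenQuotientMap_mk (X := S)).isQuotientMap.isOpen_preimage]
  have : (AntipodalQuotient.mk : S → _) ⁻¹' tautDomain S φ = {x : S | φ x ≠ 0} :=
    Set.ext fun x => mk_mem_tautDomain
  rw [this]
  exact isOpen_ne_fun (φ.continuous.comp continuous_subtype_val) continuous_const

variable [ContinuousSMul ℝ V]

theorem continuousOn_tautSection (φ : V →L[ℝ] ℝ) :
    ContinuousOn (tautSection φ) (tautDomain S φ) := by
  rw [(AntipodalQuotient.isOpenQuotientMap_mk (X := S)).isQuotientMap.continuousOn_isOpen_iff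
    (isOpen_tautDomain φ)]
  have h : Continuous fun x : S => φ x := φ.continuous.comp continuous_subtype_val
  exact (h.continuousOn.inv₀ fun x hx => mk_mem_tautDomain.1 hx).smul
    continuous_subtype_val.continuousOn

def tautTriv (φ : V →L[ℝ] ℝ) : Trivialization ℝ (π ℝ (Taut S)) where
  toFun p := (p.1, φ (tautIncl S p.1 p.2))
  invFun q := ⟨q.1, q.2 • (⟨tautSection φ q.1, tautSection_mem φ q.1⟩ : tautLine S q.1)⟩
  source := π ℝ (Taut S) ⁻¹' tautDomain S φ
  target := tautDomain S φ ×ˢ univ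
  map_source' _ h := ⟨h, mem_univ _⟩
  map_target' _ h := h.1
  left_inv' := by
    rintro ⟨b, v⟩ hb
    refine congrArg (TotalSpace.mk b) (Subtype.ext ?_)
    exact smul_tautSection hb v
  right_inv' := by
    rintro ⟨b, a⟩ ⟨hb, -⟩
    refine Prod.ext rfl ?_
    change φ (a • tautSection φ b) = a
    rw [map_smul, apply_tautSection hb, smul_eq_mul, mul_one]
  open_source := (isOpen_tautDomain φ).preimage
    (continuous_fst.comp (isInducing_taut S).continuous)
  open_target := (isOpen_tautDomain φ).prod isOpen_univ
  baseSet := tautDomain S φ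
  open_baseSet := isOpen_tautDomain φ
  continuousOn_toFun := by
    have h := (isInducing_taut S).continuous
    exact ((continuous_fst.comp h).prodMk
      (φ.continuous.comp (continuous_snd.comp h))).continuousOn
  continuousOn_invFun := by
    rw [(isInducing_taut S).continuousOn_iff]
    refine continuousOn_fst.prodMk (continuousOn_snd.smul ?_)
    exact (continuousOn_tautSection φ).comp continuousOn_fst fun q hq => hq.1
  source_eq := rfl
  target_eq := rfl
  proj_toFun _ _ := rfl

instance (φ : V →L[ℝ] ℝ) : (tautTriv (S := S) φ).IsLinear ℝ where
  linear b _ :=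
    { map_add v w := by
        change φ (tautIncl S b (v + w)) = φ (tautIncl S b v) + φ (tautIncl S b w)
        rw [map_add, map_add]
      map_smul c v := by
        change φ (tautIncl S b (c • v)) = c • φ (tautIncl S b v)
        rw [map_smul, map_smul] }

instance [SeparatingDual ℝ V] : FiberBundle ℝ (Taut S) where
  totalSpaceMk_isInducing' b := by
    refine ⟨?_⟩
    have h : IsInducing fun v : Taut S b => ((b, tautIncl S b v) : AntipodalQuotient S × V) :=
      isInducing_const_prod.2 IsInducing.subtypeVal
    rw [h.eq_induced, (isInducing_taut S).eq_induced, induced_compose]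
    rfl
  trivializationAtlas' := range tautTriv
  trivializationAt' b := tautTriv (exists_mem_tautDomain b).choose
  mem_baseSet_trivializationAt' b := (exists_mem_tautDomain b).choose_spec
  trivialization_mem_atlas' _ := mem_range_self _

instance [SeparatingDual ℝ V] : VectorBundle ℝ ℝ (Taut S) where
  trivialization_linear' := by
    rintro _ ⟨φ, rfl⟩
    infer_instance
  continuousOn_coordChange' := by
    rintro _ _ ⟨φ, rfl⟩ ⟨ψ, rfl⟩
    have h : ContinuousOn (fun b : AntipodalQuotient S => ψ (tautSection φ b))
        (tautDomain S φ ∩ tautDomain S ψ) :=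
      ψ.continuous.comp_continuousOn ((continuousOn_tautSection φ).mono inter_subset_left)
    refine ((ContinuousLinearMap.smulRightL ℝ ℝ ℝ
      (ContinuousLinearMap.id ℝ ℝ)).continuous.comp_continuousOn h).congr fun b hb => ?_
    ext
    rw [ContinuousLinearEquiv.coe_coe, Trivialization.coordChangeL_apply' _ _ hb]
    change ψ ((1 : ℝ) • tautSection φ b) = (1 : ℝ) • ψ (tautSection φ b)
    rw [map_smul]

end TautologicalBundle

section LineBundleTensor

variable {B : Type*} [TopologicalSpace B] (E₁ E₂ : B → Type*)
  [∀ b, AddCommMonoid (E₁ b)] [∀ b, Module ℝ (E₁ b)]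
  [∀ b, AddCommMonoid (E₂ b)] [∀ b, Module ℝ (E₂ b)]
  [TopologicalSpace (TotalSpace ℝ E₁)] [TopologicalSpace (TotalSpace ℝ E₂)]

/-- The tensor product of two real line bundles, with fibre `E₁ b ⊗ E₂ b` over `b`. -/
def LineTensor (b : B) : Type _ := E₁ b ⊗[ℝ] E₂ b

instance (b : B) : AddCommMonoid (LineTensor E₁ E₂ b) :=
  inferInstanceAs (AddCommMonoid (E₁ b ⊗[ℝ] E₂ b))

instance (b : B) : Module ℝ (LineTensor E₁ E₂ b) :=
  inferInstanceAs (Module ℝ (E₁ b ⊗[ℝ] E₂ b))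

variable {E₁ E₂}

def tensorFwd (e₁ : Trivialization ℝ (π ℝ E₁)) (e₂ : Trivialization ℝ (π ℝ E₂)) [e₁.IsLinear ℝ]
    [e₂.IsLinear ℝ] (b : B) : LineTensor E₁ E₂ b →ₗ[ℝ] ℝ :=
  (TensorProduct.lid ℝ ℝ).toLinearMap ∘ₗ
    TensorProduct.map (e₁.linearMapAt ℝ b) (e₂.linearMapAt ℝ b)

def tensorBwd (e₁ : Trivialization ℝ (π ℝ E₁)) (e₂ : Trivialization ℝ (π ℝ E₂)) [e₁.IsLinear ℝ]
    [e₂.IsLinear ℝ] (b : B) : ℝ →ₗ[ℝ] LineTensor E₁ E₂ b :=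
  TensorProduct.map (e₁.symmₗ ℝ b) (e₂.symmₗ ℝ b) ∘ₗ (TensorProduct.lid ℝ ℝ).symm.toLinearMap

theorem tensorFwd_tmul (e₁ : Trivialization ℝ (π ℝ E₁)) (e₂ : Trivialization ℝ (π ℝ E₂))
    [e₁.IsLinear ℝ] [e₂.IsLinear ℝ] (b : B) (v : E₁ b) (w : E₂ b) :
    tensorFwd e₁ e₂ b (v ⊗ₜ[ℝ] w) = e₁.linearMapAt ℝ b v * e₂.linearMapAt ℝ b w := rfl

theorem tensorBwd_apply (e₁ : Trivialization ℝ (π ℝ E₁)) (e₂ : Trivialization ℝ (π ℝ E₂))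
    [e₁.IsLinear ℝ] [e₂.IsLinear ℝ] (b : B) (a : ℝ) :
    tensorBwd e₁ e₂ b a = e₁.symmₗ ℝ b 1 ⊗ₜ[ℝ] e₂.symmₗ ℝ b a := rfl

theorem tensorBwd_fwd (e₁ : Trivialization ℝ (π ℝ E₁)) (e₂ : Trivialization ℝ (π ℝ E₂))
    [e₁.IsLinear ℝ] [e₂.IsLinear ℝ] {b : B} (h₁ : b ∈ e₁.baseSet) (h₂ : b ∈ e₂.baseSet)
    (t : LineTensor E₁ E₂ b) : tensorBwd e₁ e₂ b (tensorFwd e₁ e₂ b t) = t := by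
  have : tensorBwd e₁ e₂ b ∘ₗ tensorFwd e₁ e₂ b = LinearMap.id := by
    refine TensorProduct.ext' fun v w => ?_
    change TensorProduct.map (e₁.symmₗ ℝ b) (e₂.symmₗ ℝ b) ((TensorProduct.lid ℝ ℝ).symm
      (TensorProduct.lid ℝ ℝ (e₁.linearMapAt ℝ b v ⊗ₜ[ℝ] e₂.linearMapAt ℝ b w))) = v ⊗ₜ[ℝ] w
    rw [LinearEquiv.symm_apply_apply, TensorProduct.map_tmul, e₁.symmₗ_linearMapAt h₁,
      e₂.symmₗ_linearMapAt h₂]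
  exact LinearMap.congr_fun this t

theorem tensorFwd_bwd (e₁ : Trivialization ℝ (π ℝ E₁)) (e₂ : Trivialization ℝ (π ℝ E₂))
    [e₁.IsLinear ℝ] [e₂.IsLinear ℝ] {b : B} (h₁ : b ∈ e₁.baseSet) (h₂ : b ∈ e₂.baseSet)
    (a : ℝ) : tensorFwd e₁ e₂ b (tensorBwd e₁ e₂ b a) = a := by
  rw [tensorBwd_apply, tensorFwd_tmul, e₁.linearMapAt_symmₗ h₁, e₂.linearMapAt_symmₗ h₂, one_mul]

/-- Trivializations `e₁`, `e₂` of `E₁`, `E₂` induce the trivialization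
`v ⊗ w ↦ e₁ v * e₂ w` of the tensor product. -/
def tensorPretriv (e₁ : Trivialization ℝ (π ℝ E₁)) (e₂ : Trivialization ℝ (π ℝ E₂))
    [e₁.IsLinear ℝ] [e₂.IsLinear ℝ] : Pretrivialization ℝ (π ℝ (LineTensor E₁ E₂)) where
  toFun p := (p.1, tensorFwd e₁ e₂ p.1 p.2)
  invFun q := ⟨q.1, tensorBwd e₁ e₂ q.1 q.2⟩
  source := π ℝ (LineTensor E₁ E₂) ⁻¹' (e₁.baseSet ∩ e₂.baseSet)
  target := (e₁.baseSet ∩ e₂.baseSet) ×ˢ univ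
  map_source' _ h := ⟨h, mem_univ _⟩
  map_target' _ h := h.1
  left_inv' := by
    rintro ⟨b, t⟩ ⟨h₁, h₂⟩
    exact congrArg (TotalSpace.mk b) (tensorBwd_fwd e₁ e₂ h₁ h₂ t)
  right_inv' := by
    rintro ⟨b, a⟩ ⟨⟨h₁, h₂⟩, -⟩
    exact Prod.ext rfl (tensorFwd_bwd e₁ e₂ h₁ h₂ a)
  open_target := (e₁.open_baseSet.inter e₂.open_baseSet).prod isOpen_univ
  baseSet := e₁.baseSet ∩ e₂.baseSet
  open_baseSet := e₁.open_baseSet.inter e₂.open_baseSet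
  source_eq := rfl
  target_eq := rfl
  proj_toFun _ _ := rfl

instance (e₁ : Trivialization ℝ (π ℝ E₁)) (e₂ : Trivialization ℝ (π ℝ E₂))
    [e₁.IsLinear ℝ] [e₂.IsLinear ℝ] : (tensorPretriv e₁ e₂).IsLinear ℝ where
  linear b _ := (tensorFwd e₁ e₂ b).isLinear

variable [∀ b, TopologicalSpace (E₁ b)] [FiberBundle ℝ E₁] [VectorBundle ℝ ℝ E₁]
  [∀ b, TopologicalSpace (E₂ b)] [FiberBundle ℝ E₂] [VectorBundle ℝ ℝ E₂]

/-- The topology of the fibre, a line, transported from `ℝ` by a linear isomorphism. -/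
instance (b : B) : TopologicalSpace (LineTensor E₁ E₂ b) :=
  TopologicalSpace.induced
    (tensorFwd (FiberBundle.trivializationAt ℝ E₁ b) (FiberBundle.trivializationAt ℝ E₂ b) b)
    inferInstance

variable (E₁ E₂)

def lineTensorPrebundle : VectorPrebundle ℝ ℝ (LineTensor E₁ E₂) where
  pretrivializationAtlas :=
    {e | ∃ (e₁ : Trivialization ℝ (π ℝ E₁)) (e₂ : Trivialization ℝ (π ℝ E₂))
      (_ : MemTrivializationAtlas e₁) (_ : MemTrivializationAtlas e₂), e = tensorPretriv e₁ e₂}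
  pretrivialization_linear' := by
    rintro _ ⟨e₁, e₂, h₁, h₂, rfl⟩
    infer_instance
  pretrivializationAt b :=
    tensorPretriv (FiberBundle.trivializationAt ℝ E₁ b) (FiberBundle.trivializationAt ℝ E₂ b)
  mem_base_pretrivializationAt b := ⟨FiberBundle.mem_baseSet_trivializationAt ℝ E₁ b,
    FiberBundle.mem_baseSet_trivializationAt ℝ E₂ b⟩
  pretrivialization_mem_atlas b := ⟨_, _, inferInstance, inferInstance, rfl⟩
  exists_coordChange := by
    rintro _ ⟨e₁, e₂, h₁, h₂, rfl⟩ _ ⟨e₁', e₂', h₁', h₂', rfl⟩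
    let c : B → ℝ := fun b => e₁.coordChangeL ℝ e₁' b 1 * e₂.coordChangeL ℝ e₂' b 1
    have hc : ContinuousOn c ((e₁.baseSet ∩ e₂.baseSet) ∩ (e₁'.baseSet ∩ e₂'.baseSet)) := by
      refine ContinuousOn.mul ?_ ?_
      · exact ((continuousOn_coordChange ℝ e₁ e₁').clm_apply continuousOn_const).mono
          fun b hb => ⟨hb.1.1, hb.2.1⟩
      · exact ((continuousOn_coordChange ℝ e₂ e₂').clm_apply continuousOn_const).mono
          fun b hb => ⟨hb.1.2, hb.2.2⟩
    refine ⟨fun b => ContinuousLinearMap.smulRightL ℝ ℝ ℝ (ContinuousLinearMap.id ℝ ℝ) (c b),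
      (ContinuousLinearMap.smulRightL ℝ ℝ ℝ
        (ContinuousLinearMap.id ℝ ℝ)).continuous.comp_continuousOn hc, ?_⟩
    rintro b ⟨hb, hb'⟩ a
    have hs : (tensorPretriv e₁ e₂).symm b a = tensorBwd e₁ e₂ b a :=
      Pretrivialization.symm_apply _ hb a
    rw [hs]
    change a • c b = tensorFwd e₁' e₂' b (tensorBwd e₁ e₂ b a)
    have ha : tensorBwd e₁ e₂ b a = a • tensorBwd e₁ e₂ b 1 := by
      rw [← map_smul, smul_eq_mul, mul_one]
    rw [ha, map_smul, tensorBwd_apply, tensorFwd_tmul]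
    simp only [c]
    rw [e₁.coordChangeL_apply e₁' ⟨hb.1, hb'.1⟩, e₂.coordChangeL_apply e₂' ⟨hb.2, hb'.2⟩,
      e₁'.coe_linearMapAt_of_mem hb'.1, e₂'.coe_linearMapAt_of_mem hb'.2,
      e₁.symmₗ_apply hb.1, e₂.symmₗ_apply hb.2]
  totalSpaceMk_isInducing b := isInducing_const_prod.2 ⟨rfl⟩

/-- The topology on the total space of the tensor product for which the maps
`v ⊗ w ↦ e₁ v * e₂ w` are local trivializations. -/
instance : TopologicalSpace (TotalSpace ℝ (LineTensor E₁ E₂)) :=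
  (lineTensorPrebundle E₁ E₂).totalSpaceTopology

instance : FiberBundle ℝ (LineTensor E₁ E₂) := (lineTensorPrebundle E₁ E₂).toFiberBundle

instance : VectorBundle ℝ ℝ (LineTensor E₁ E₂) := (lineTensorPrebundle E₁ E₂).toVectorBundle

end LineBundleTensor

/-- Isomorphism of real line bundles over `B`: a family of linear isomorphisms of the fibres that
is a homeomorphism of the total spaces. -/
def LineBundleIso {B : Type*} (E₁ E₂ : B → Type*)
    [∀ b, AddCommMonoid (E₁ b)] [∀ b, Module ℝ (E₁ b)]
    [∀ b, AddCommMonoid (E₂ b)] [∀ b, Module ℝ (E₂ b)]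
    [TopologicalSpace (TotalSpace ℝ E₁)] [TopologicalSpace (TotalSpace ℝ E₂)] : Prop :=
  ∃ θ : ∀ b, E₁ b ≃ₗ[ℝ] E₂ b, IsHomeomorph
    (fun p : TotalSpace ℝ E₁ => (⟨p.1, θ p.1 p.2⟩ : TotalSpace ℝ E₂))

/-- The Hopf line bundle `ξ_m` over `RP^m`. -/
def hopfBundle (m : ℕ) : RP m → Type := Taut (RealSphere m)

instance (m : ℕ) (b : RP m) : AddCommGroup (hopfBundle m b) :=
  inferInstanceAs (AddCommGroup (Taut (RealSphere m) b))

instance (m : ℕ) (b : RP m) : Module ℝ (hopfBundle m b) :=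
  inferInstanceAs (Module ℝ (Taut (RealSphere m) b))

instance (m : ℕ) (b : RP m) : TopologicalSpace (hopfBundle m b) :=
  inferInstanceAs (TopologicalSpace (Taut (RealSphere m) b))

instance (m : ℕ) : TopologicalSpace (TotalSpace ℝ (hopfBundle m)) :=
  inferInstanceAs (TopologicalSpace (TotalSpace ℝ (Taut (RealSphere m))))

instance (m : ℕ) : FiberBundle ℝ (hopfBundle m) := inferInstanceAs (FiberBundle ℝ (Taut (RealSphere m)))

instance (m : ℕ) : VectorBundle ℝ ℝ (hopfBundle m) := inferInstanceAs (VectorBundle ℝ ℝ (Taut (RealSphere m)))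
/-- The universal (Hopf) line bundle over `RP^∞`. -/
def univLine : RPInf → Type := Taut InfSphere

instance (b : RPInf) : AddCommGroup (univLine b) :=
  inferInstanceAs (AddCommGroup (Taut InfSphere b))

instance (b : RPInf) : Module ℝ (univLine b) :=
  inferInstanceAs (Module ℝ (Taut InfSphere b))

instance (b : RPInf) : TopologicalSpace (univLine b) :=
  inferInstanceAs (TopologicalSpace (Taut InfSphere b))

instance : TopologicalSpace (TotalSpace ℝ univLine) :=
  inferInstanceAs (TopologicalSpace (TotalSpace ℝ (Taut InfSphere)))

instance : FiberBundle ℝ univLine := inferInstanceAs (FiberBundle ℝ (Taut InfSphere))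

instance : VectorBundle ℝ ℝ univLine := inferInstanceAs (VectorBundle ℝ ℝ (Taut InfSphere))

/-- `f : B → RP^∞` classifies the line bundle `E` over `B`: the pullback along `f` of the universal
line bundle is isomorphic to `E`. -/
def ClassifiesLineBundle {B : Type*} [TopologicalSpace B] (f : C(B, RPInf)) (E : B → Type*)
    [∀ b, AddCommMonoid (E b)] [∀ b, Module ℝ (E b)] [TopologicalSpace (TotalSpace ℝ E)] : Prop :=
  LineBundleIso (f *ᵖ univLine) E

/-- The projection of a power `X^n` onto its `j`-th factor. -/
def coordProj {X : Type*} [TopologicalSpace X] {n : ℕ} (j : Fin n) : C(Fin n → X, X) where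
  toFun x := x j
  continuous_toFun := continuous_apply j

end ProjectiveProduct

noncomputable section

/-! ### Principal bundles of discrete groups -/

/-! Everything is read off from sign laws on the cover `(S^m)^s → (RP^m)^s`, which is an open
quotient map. A map `μ` classifying `πₛ` yields an equivariant `F : ProjProd m s → (S^∞)^(s-1)` over
it. Two points `x`, `y` of `(S^m)^s` with the same image differ by a flip and possibly the global
antipode, so `yᵢ = u xᵢ` and `yₛ = v xₛ` with `u, v = ±1`. Equivariance of `F`, and its being
defined on the antipodal quotient, give `Fᵢ(y) = uv Fᵢ(x)` (`exists_units_of_equivariant`).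

The line bundle statement follows because `Fᵢ` frames the pulled-back tautological bundle with the
law `uv`, while `xᵢ` and `xₛ` frame the two Hopf bundles with the laws `u` and `v`. Frames with
equal laws over an open quotient of the base determine an isomorphism (`LineBundleIso.of_frames`,
`LineBundleIso.lineTensor_of_frames`).

For the homotopy, the normalized polynomial product `xᵢ xₛ` obeys the same law `uv`. Any two lifts
`F`, `G` with a common law, the second of degree less than some `n > 0`, give homotopic maps: join
`F` to `Xⁿ F` and then `Xⁿ F` to `G` by segments, neither of which meets the origin
(`homotopic_of_bounded`). No classification theorem for principal bundles or line bundles is needed.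

Existence of a classifying map comes from the products `xᵢ xₛ` themselves, which define an
equivariant map `hopfLift`; compactness turns it into a pullback square. Signs of linear functionals
on `hopfLift` give local equivariant maps to the group, hence local triviality of `πₛ`. -/

/-- Discreteness cuts an open set into the open pieces on which `σ` is constant, and on each piece
the image is a product of open sets. -/
theorem IsOpenMap.prodMk_of_discrete {P B G : Type*} [TopologicalSpace P] [TopologicalSpace B]
    [TopologicalSpace G] [DiscreteTopology G] {f : P → B} (hf : IsOpenMap f) {σ : P → G}
    (hσ : Continuous σ) : IsOpenMap fun p => (f p, σ p) := by
  intro W hW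
  have h : (fun p => (f p, σ p)) '' W = ⋃ g, (f '' (W ∩ σ ⁻¹' {g})) ×ˢ {g} := by
    ext ⟨b, g⟩
    simp only [mem_image, Prod.mk.injEq, mem_iUnion, mem_prod, mem_inter_iff, mem_preimage,
      mem_singleton_iff]
    constructor
    · rintro ⟨p, hp, rfl, rfl⟩
      exact ⟨σ p, ⟨p, ⟨hp, rfl⟩, rfl⟩, rfl⟩
    · rintro ⟨_, ⟨p, ⟨hp, h⟩, rfl⟩, rfl⟩
      exact ⟨p, hp, rfl, h⟩
  rw [h]
  exact isOpen_iUnion fun g =>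
    (hf _ (hW.inter ((isOpen_discrete _).preimage hσ))).prod (isOpen_discrete _)

/-- If the fibres of an open surjection `proj` are the orbits of a discrete group `G`, local
equivariant maps to `G` are local trivializations. -/
theorem IsPrincipalBundle.of_local_equivariant {G P B : Type*} [Group G] [TopologicalSpace G]
    [DiscreteTopology G] [TopologicalSpace P] [TopologicalSpace B] [MulAction G P] (proj : C(P, B))
    (hopen : IsOpenMap proj) (hsurj : Function.Surjective proj)
    (hsmul : ∀ (g : G) (p : P), proj (g • p) = proj p)
    (horb : ∀ p p', proj p = proj p' → ∃ g : G, p' = g • p)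
    (hloc : ∀ b, ∃ U : Set B, IsOpen U ∧ b ∈ U ∧ ∃ σ : P → G, ContinuousOn σ (proj ⁻¹' U) ∧
      ∀ (g : G) (p : P), proj p ∈ U → σ (g • p) = g * σ p) : IsPrincipalBundle G proj where
  proj_smul := hsmul
  locally_trivial b := by
    obtain ⟨U, hU, hb, σ, hσ, hσg⟩ := hloc b
    let F : (proj ⁻¹' U) → U × G := fun p => (U.restrictPreimage proj p, σ p)
    have hσ' : Continuous fun p : proj ⁻¹' U => σ p := continuousOn_iff_continuous_domRestrict.1 hσ
    have hFc : Continuous F := (proj.continuous.restrictPreimage).prodMk hσ'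
    have hFo : IsOpenMap F := (hopen.restrictPreimage U).prodMk_of_discrete hσ'
    have hF : Function.Bijective F := by
      constructor
      -- Freeness need not be assumed: comparing values of `σ` forces `g = 1`.
      · rintro ⟨p, hp⟩ ⟨p', hp'⟩ h
        have h1 : proj p = proj p' := congrArg (fun z : U × G => (z.1 : B)) h
        have h2 : σ p = σ p' := congrArg Prod.snd h
        obtain ⟨g, rfl⟩ := horb _ _ h1
        rw [hσg g p hp, eq_comm, mul_eq_right] at h2
        simp [h2]
      · rintro ⟨⟨b, hb⟩, h⟩
        obtain ⟨p, rfl⟩ := hsurj b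
        refine ⟨⟨(h * (σ p)⁻¹) • p, by rw [mem_preimage, hsmul]; exact hb⟩, Prod.ext ?_ ?_⟩
        · exact Subtype.ext (hsmul _ _)
        · change σ ((h * (σ p)⁻¹) • p) = h
          rw [hσg _ _ hb, inv_mul_cancel_right]
    refine ⟨U, hU, hb, (Equiv.ofBijective F hF).toHomeomorphOfContinuousOpen hFc hFo,
      fun p => rfl, fun g p q h => ?_⟩
    change σ q.1 = g * σ p.1
    rw [h, hσg g p.1 p.2]

/-- An equivariant map of compact total spaces over `f`, between free actions whose orbits are the
fibres, exhibits a pullback. -/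
theorem ClassifiesPrincipal.of_equivariant {G P B E BG : Type*} [Group G] [TopologicalSpace P]
    [TopologicalSpace B] [TopologicalSpace E] [TopologicalSpace BG] [MulAction G P] [MulAction G E]
    [CompactSpace P] [T2Space B] [T2Space E] {q : C(E, BG)} {f : C(B, BG)} {proj : C(P, B)}
    (hsurj : Function.Surjective proj)
    (hsmul : ∀ (g : G) (p : P), proj (g • p) = proj p)
    (horb : ∀ p p', proj p = proj p' → ∃ g : G, p' = g • p)
    (hfree : ∀ (g : G) (e : E), g • e = e → g = 1)
    (horbE : ∀ e e', q e = q e' → ∃ g : G, e' = g • e)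
    (F : C(P, E)) (hF : ∀ p, f (proj p) = q (F p)) (hFg : ∀ (g : G) p, F (g • p) = g • F p) :
    ClassifiesPrincipal G q f proj := by
  let Φ : P → {z : B × E // f z.1 = q z.2} := fun p => ⟨(proj p, F p), hF p⟩
  have hΦc : Continuous Φ := (proj.continuous.prodMk F.continuous).subtype_mk _
  -- Injectivity uses transitivity on the fibres of `proj` and freeness on `E`; surjectivity uses
  -- transitivity on the fibres of `q`.
  have hΦ : Function.Bijective Φ := by
    constructor
    · intro p p' h
      have h1 : proj p = proj p' := congrArg (fun z => z.1.1) h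
      have h2 : F p = F p' := congrArg (fun z => z.1.2) h
      obtain ⟨g, rfl⟩ := horb _ _ h1
      rw [hFg] at h2
      rw [hfree g _ h2.symm, one_smul]
    · rintro ⟨⟨b, e⟩, h⟩
      obtain ⟨p, rfl⟩ := hsurj b
      obtain ⟨g, rfl⟩ := horbE (F p) e ((hF p).symm.trans h)
      exact ⟨g • p, Subtype.ext (Prod.ext (hsmul g p) (hFg g p))⟩
  -- Compactness of `P` and the Hausdorff property of the pullback make the inverse continuous, with
  -- no appeal to local triviality.
  exact ⟨Continuous.homeoOfEquivCompactToT2 (f := Equiv.ofBijective Φ hΦ) hΦc,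
    fun p => rfl, fun g p => hFg g p⟩

/-! ### Spheres and projective spaces -/

theorem RealSphere.units_smul_def {m : ℕ} (u : ℤˣ) (x : RealSphere m) :
    u • x = if u = 1 then x else -x := rfl

theorem InfSphere.units_smul_def (u : ℤˣ) (x : InfSphere) :
    u • x = if u = 1 then x else -x := rfl

theorem RealSphere.neg_one_smul {m : ℕ} (x : RealSphere m) : (-1 : ℤˣ) • x = -x :=
  if_neg (by decide)

theorem InfSphere.neg_one_smul (x : InfSphere) : (-1 : ℤˣ) • x = -x :=
  if_neg (by decide)

theorem InfSphere.coe_neg (f : InfSphere) : ((-f : InfSphere) : RInf) = -(f : RInf) := rfl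

theorem InfSphere.neg_ne_self (f : InfSphere) : -f ≠ f := by
  intro h
  have h1 : -f.1 = f.1 := congrArg Subtype.val h
  exact InfSphere.ne_zero f (self_eq_neg.1 h1.symm)

instance : T2Space RInf :=
  T2Space.of_injective_continuous (f := fun (f : RInf) k => f.coeff k)
    (fun _ _ h => Polynomial.ext (congrFun h)) (continuous_pi RInf.continuous_coeff)

/-- The orbit relation is closed, being the union of the graphs of the identity and of negation. -/
instance AntipodalQuotient.instT2Space (X : Type*) [InvolutiveNeg X] [TopologicalSpace X]
    [ContinuousNeg X] [T2Space X] : T2Space (AntipodalQuotient X) := by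
  rw [t2Space_iff_of_isOpenQuotientMap AntipodalQuotient.isOpenQuotientMap_mk]
  have h : {q : X × X | AntipodalQuotient.mk q.1 = AntipodalQuotient.mk q.2} =
      {q | q.2 = q.1} ∪ {q | q.2 = -q.1} := by
    ext q
    exact AntipodalQuotient.mk_eq_mk
  rw [h]
  exact (isClosed_eq continuous_snd continuous_fst).union
    (isClosed_eq continuous_snd continuous_fst.neg)

theorem sphereInclusion_smul {m : ℕ} (u : ℤˣ) (x : RealSphere m) :
    sphereInclusion m (u • x) = u • sphereInclusion m x := by
  rcases Int.units_eq_one_or u with rfl | rfl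
  · simp only [one_smul]
  · rw [RealSphere.neg_one_smul, InfSphere.neg_one_smul, sphereInclusion_neg]

theorem sphereMul_smul_left (u : ℤˣ) (f g : InfSphere) :
    sphereMul (u • f) g = u • sphereMul f g := by
  rcases Int.units_eq_one_or u with rfl | rfl
  · simp only [one_smul]
  · rw [InfSphere.neg_one_smul, InfSphere.neg_one_smul, sphereMul_neg_left]

/-- The product of the double covers `S^m → RP^m`. -/
def spherePowProj (m s : ℕ) : (Fin s → RealSphere m) → Fin s → RP m :=
  Pi.map fun _ => AntipodalQuotient.mk

theorem isOpenQuotientMap_spherePowProj (m s : ℕ) : IsOpenQuotientMap (spherePowProj m s) :=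
  IsOpenQuotientMap.piMap fun _ => AntipodalQuotient.isOpenQuotientMap_mk

theorem smul_mk {m s : ℕ} (g : SignGroup s) (x : Fin s → RealSphere m) :
    g • (AntipodalQuotient.mk x : ProjProd m s) = AntipodalQuotient.mk (flipSigns g x) := rfl

/-- The last index. -/
abbrev Fin.lastOf {s : ℕ} (hs : 2 ≤ s) : Fin s := ⟨s - 1, by omega⟩

/-- The index `i < s - 1` as an index below `s`. -/
abbrev Fin.initOf {s : ℕ} (i : Fin (s - 1)) : Fin s := ⟨i, by omega⟩

theorem flipSigns_initOf {m s : ℕ} (g : SignGroup s) (x : Fin s → RealSphere m) (i : Fin (s - 1)) :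
    flipSigns g x i.initOf = g i • x i.initOf := by
  simp [flipSigns]

theorem flipSigns_lastOf {m s : ℕ} (hs : 2 ≤ s) (g : SignGroup s) (x : Fin s → RealSphere m) :
    flipSigns g x (Fin.lastOf hs) = x (Fin.lastOf hs) := by
  simp [flipSigns]

theorem flipSigns_neg {m s : ℕ} (g : SignGroup s) (x : Fin s → RealSphere m) :
    flipSigns g (-x) = -flipSigns g x := by
  funext j
  simp only [flipSigns, Pi.neg_apply]
  split_ifs
  · exact RealSphere.smul_neg _ _
  · rfl

/-- The group flips every coordinate but the last, so agreement there is the only constraint. -/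
theorem exists_flipSigns_of_lastOf_eq {m s : ℕ} (hs : 2 ≤ s) {x y : Fin s → RealSphere m}
    (h : spherePowProj m s x = spherePowProj m s y) (hl : y (Fin.lastOf hs) = x (Fin.lastOf hs)) :
    ∃ g : SignGroup s, y = flipSigns g x := by
  have hu : ∀ j, ∃ u : ℤˣ, y j = u • x j := fun j => by
    rcases AntipodalQuotient.mk_eq_mk.1 (congrFun h j) with h | h
    · exact ⟨1, by rw [one_smul, h]⟩
    · exact ⟨-1, by rw [RealSphere.neg_one_smul, h]⟩
  choose u hu using hu
  refine ⟨fun i => u i.initOf, funext fun j => ?_⟩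
  simp only [flipSigns]
  split_ifs with hj
  · exact hu j
  · obtain rfl : j = Fin.lastOf hs := Fin.ext (by have := j.2; simp only; omega)
    exact hl

/-- If the last coordinates are opposite, replacing `x` by `-x` reduces to the case where they
agree. -/
theorem exists_flipSigns {m s : ℕ} (hs : 2 ≤ s) {x y : Fin s → RealSphere m}
    (h : spherePowProj m s x = spherePowProj m s y) :
    ∃ g : SignGroup s, y = flipSigns g x ∨ y = -flipSigns g x := by
  rcases AntipodalQuotient.mk_eq_mk.1 (congrFun h (Fin.lastOf hs)) with hl | hl
  · obtain ⟨g, hg⟩ := exists_flipSigns_of_lastOf_eq hs h hl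
    exact ⟨g, Or.inl hg⟩
  · have h' : spherePowProj m s (-x) = spherePowProj m s y := by
      rw [← h]
      exact funext fun j => AntipodalQuotient.mk_neg (x j)
    obtain ⟨g, hg⟩ := exists_flipSigns_of_lastOf_eq hs h' hl
    exact ⟨g, Or.inr (by rw [hg, flipSigns_neg])⟩

theorem piProj_surjective (m s : ℕ) : Function.Surjective (piProj m s) := fun b => by
  obtain ⟨x, rfl⟩ := (isOpenQuotientMap_spherePowProj m s).surjective b
  exact ⟨AntipodalQuotient.mk x, rfl⟩

theorem isOpenMap_piProj (m s : ℕ) : IsOpenMap (piProj m s) :=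
  IsOpenMap.of_comp (f := (AntipodalQuotient.mk : (Fin s → RealSphere m) → ProjProd m s))
    AntipodalQuotient.isOpenQuotientMap_mk.continuous
    AntipodalQuotient.isOpenQuotientMap_mk.surjective
    (isOpenQuotientMap_spherePowProj m s).isOpenMap

theorem piProj_smul {m s : ℕ} (g : SignGroup s) (p : ProjProd m s) :
    piProj m s (g • p) = piProj m s p := by
  induction p using Quotient.inductionOn with | _ x
  funext j
  change AntipodalQuotient.mk (flipSigns g x j) = AntipodalQuotient.mk (x j)
  simp only [flipSigns, RealSphere.units_smul_def]
  split_ifs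
  · rfl
  · exact AntipodalQuotient.mk_neg _
  · rfl

theorem exists_smul_of_piProj_eq {m s : ℕ} (hs : 2 ≤ s) (p p' : ProjProd m s)
    (h : piProj m s p = piProj m s p') : ∃ g : SignGroup s, p' = g • p := by
  induction p using Quotient.inductionOn with | _ x
  induction p' using Quotient.inductionOn with | _ y
  obtain ⟨g, rfl | rfl⟩ := exists_flipSigns hs h
  · exact ⟨g, rfl⟩
  · exact ⟨g, AntipodalQuotient.mk_neg _⟩

theorem univ_smul_eq_self {r : ℕ} (g : Fin r → ℤˣ) (e : Fin r → InfSphere) (h : g • e = e) :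
    g = 1 := by
  funext i
  rcases Int.units_eq_one_or (g i) with hi | hi
  · exact hi
  · have h1 : g i • e i = e i := congrFun h i
    rw [hi, InfSphere.neg_one_smul] at h1
    exact absurd h1 (InfSphere.neg_ne_self _)

theorem exists_smul_of_univProj_eq {r : ℕ} (e e' : Fin r → InfSphere)
    (h : univProj r e = univProj r e') : ∃ g : Fin r → ℤˣ, e' = g • e := by
  have hu : ∀ j, ∃ u : ℤˣ, e' j = u • e j := fun j => by
    rcases AntipodalQuotient.mk_eq_mk.1 (congrFun h j) with h | h
    · exact ⟨1, by rw [one_smul, h]⟩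
    · exact ⟨-1, by rw [InfSphere.neg_one_smul, h]⟩
  choose u hu using hu
  exact ⟨u, funext hu⟩

/-! ### The standard classifying map -/

/-- The map `(x₁, …, xₛ) ↦ (x₁ xₛ, …, xₛ₋₁ xₛ)`, with the multiplication of polynomials. -/
def hopfLift (m s : ℕ) (hs : 2 ≤ s) : C(ProjProd m s, Fin (s - 1) → InfSphere) where
  toFun := Quotient.lift (fun x i => sphereMul (sphereInclusion m (x i.initOf))
      (sphereInclusion m (x (Fin.lastOf hs)))) <| by
    rintro x y (rfl | rfl)
    · rfl
    · funext i
      simp only [Pi.neg_apply, sphereInclusion_neg, sphereMul_neg_left, sphereMul_neg_right,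
        neg_neg]
  continuous_toFun := Continuous.quotient_lift (continuous_pi fun i =>
    continuous_sphereMul.comp (((continuous_sphereInclusion m).comp (continuous_apply i.initOf)).prodMk
      ((continuous_sphereInclusion m).comp (continuous_apply (Fin.lastOf hs))))) _

/-- The action fixes the last coordinate, so only the first factor of each product picks up a sign.
-/
theorem hopfLift_smul {m s : ℕ} (hs : 2 ≤ s) (g : SignGroup s) (p : ProjProd m s) :
    hopfLift m s hs (g • p) = g • hopfLift m s hs p := by
  induction p using Quotient.inductionOn with | _ x
  funext i
  change sphereMul (sphereInclusion m (flipSigns g x i.initOf))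
    (sphereInclusion m (flipSigns g x (Fin.lastOf hs))) = g i • sphereMul _ _
  rw [flipSigns_initOf, flipSigns_lastOf, sphereInclusion_smul, sphereMul_smul_left]

/-- The map `b ↦ bᵢ bₛ` with the Hopf multiplication. -/
def hopfComponent (m s : ℕ) (hs : 2 ≤ s) (i : Fin (s - 1)) : C(Fin s → RP m, RPInf) :=
  hopfMul.comp (((rpInclusion m).prodMap (rpInclusion m)).comp
    ((coordProj i.initOf).prodMk (coordProj (Fin.lastOf hs))))

theorem univProj_hopfLift {m s : ℕ} (hs : 2 ≤ s) (p : ProjProd m s) :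
    ContinuousMap.pi (hopfComponent m s hs) (piProj m s p) =
      univProj (s - 1) (hopfLift m s hs p) := by
  induction p using Quotient.inductionOn with | _ x
  rfl

theorem exists_classifiesPrincipal_piProj (m s : ℕ) (hs : 2 ≤ s) :
    ∃ μ : C(Fin s → RP m, Fin (s - 1) → RPInf),
      ClassifiesPrincipal (SignGroup s) (univProj (s - 1)) μ (piProj m s) :=
  ⟨ContinuousMap.pi (hopfComponent m s hs), ClassifiesPrincipal.of_equivariant
    (piProj_surjective m s) piProj_smul (exists_smul_of_piProj_eq hs) univ_smul_eq_self
    exists_smul_of_univProj_eq (hopfLift m s hs) (univProj_hopfLift hs) (hopfLift_smul hs)⟩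

/-- The sign of a real number, as a unit; `0` has sign `-1`. -/
def signUnit (r : ℝ) : ℤˣ := if 0 < r then 1 else -1

theorem continuousAt_signUnit {r : ℝ} (hr : r ≠ 0) : ContinuousAt signUnit r := by
  rcases lt_or_gt_of_ne hr with h | h
  · refine (continuousAt_const (y := (-1 : ℤˣ))).congr ?_
    filter_upwards [gt_mem_nhds h] with t ht
    exact (if_neg ht.not_gt).symm
  · refine (continuousAt_const (y := (1 : ℤˣ))).congr ?_
    filter_upwards [lt_mem_nhds h] with t ht
    exact (if_pos ht).symm

theorem signUnit_neg {r : ℝ} (hr : r ≠ 0) : signUnit (-r) = -signUnit r := by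
  rcases lt_or_gt_of_ne hr with h | h
  · simp [signUnit, h, h.not_gt]
  · simp [signUnit, h, h.not_gt]

/-- Local triviality is pulled back through `hopfLift`: where a functional does not vanish on the
line `[xᵢ xₛ]`, its sign on the vector `xᵢ xₛ` is a locally constant coordinate in `ℤˣ` that flips
with `gᵢ`. -/
theorem isPrincipalBundle_piProj (m s : ℕ) (hs : 2 ≤ s) :
    IsPrincipalBundle (SignGroup s) (piProj m s) := by
  refine IsPrincipalBundle.of_local_equivariant _ (isOpenMap_piProj m s) (piProj_surjective m s)
    piProj_smul (exists_smul_of_piProj_eq hs) fun b => ?_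
  -- One functional per component, nonzero on the line over `b`; the trivializing set is where all
  -- of them remain nonzero.
  choose φ hφ using fun i => exists_mem_tautDomain (S := InfSphere) (hopfComponent m s hs i b)
  have hne : ∀ (p : ProjProd m s), (∀ i, hopfComponent m s hs i (piProj m s p) ∈
      tautDomain InfSphere (φ i)) → ∀ i, φ i (hopfLift m s hs p i).1 ≠ 0 := fun p hp i => by
    have h1 : hopfComponent m s hs i (piProj m s p) = AntipodalQuotient.mk (hopfLift m s hs p i) :=
      congrFun (univProj_hopfLift hs p) i
    have h2 := hp i
    rw [h1] at h2
    exact mk_mem_tautDomain.1 h2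
  refine ⟨⋂ i, hopfComponent m s hs i ⁻¹' tautDomain InfSphere (φ i),
    isOpen_iInter_of_finite fun i => (isOpen_tautDomain (φ i)).preimage
      (hopfComponent m s hs i).continuous, mem_iInter.2 hφ,
    fun p i => signUnit (φ i (hopfLift m s hs p i).1), ?_, fun g p hp => ?_⟩
  · refine continuousOn_pi.2 fun i p hp => ContinuousAt.continuousWithinAt ?_
    refine ContinuousAt.comp (f := fun p => φ i (hopfLift m s hs p i).1)
      (continuousAt_signUnit (hne p (mem_iInter.1 hp) i)) ?_
    exact ((φ i).continuous.comp (continuous_subtype_val.comp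
      ((continuous_apply i).comp (hopfLift m s hs).continuous))).continuousAt
  · funext i
    have h := hne p (mem_iInter.1 hp) i
    have h1 : hopfLift m s hs (g • p) i = g i • hopfLift m s hs p i :=
      congrFun (hopfLift_smul hs g p) i
    simp only [Pi.mul_apply, h1]
    rcases Int.units_eq_one_or (g i) with hi | hi
    · rw [hi, one_smul, one_mul]
    · rw [hi, InfSphere.neg_one_smul, InfSphere.coe_neg, map_neg, signUnit_neg h, neg_one_mul]

/-! ### Line bundles with frames over an open quotient of the base -/

section PureTensors

variable {B : Type*} {E E' : B → Type*} [∀ b, AddCommMonoid (E b)] [∀ b, Module ℝ (E b)]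
  [∀ b, AddCommMonoid (E' b)] [∀ b, Module ℝ (E' b)]

/-- The pure tensor `v ⊗ w` in the tensor product of two line bundles. -/
def LineTensor.tmul {b : B} (v : E b) (w : E' b) : LineTensor E E' b := v ⊗ₜ[ℝ] w

/-- Equalities are stated in total spaces because the vectors lie in fibres over points that are
only propositionally equal. -/
theorem LineTensor.mk_tmul_smul {b b' : B} {v : E b} {w : E' b} {v' : E b'} {w' : E' b'}
    {u u' : ℝ} (h : (⟨b, v⟩ : TotalSpace ℝ E) = ⟨b', u • v'⟩)
    (h' : (⟨b, w⟩ : TotalSpace ℝ E') = ⟨b', u' • w'⟩) :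
    (⟨b, LineTensor.tmul v w⟩ : TotalSpace ℝ (LineTensor E E')) =
      ⟨b', (u * u') • LineTensor.tmul v' w'⟩ := by
  obtain rfl : b = b' := congrArg TotalSpace.proj h
  obtain rfl := TotalSpace.mk_injective _ h
  obtain rfl := TotalSpace.mk_injective _ h'
  exact congrArg (TotalSpace.mk b) (TensorProduct.smul_tmul_smul u u' v' w')

end PureTensors

/-! ### Frames of line bundles along a map to the base -/

section Frames

variable {B X : Type*} [TopologicalSpace B] [TopologicalSpace X] {E : B → Type*}
  [∀ b, AddCommMonoid (E b)] [∀ b, Module ℝ (E b)] [TopologicalSpace (TotalSpace ℝ E)]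
  [∀ b, TopologicalSpace (E b)] [FiberBundle ℝ E] [VectorBundle ℝ ℝ E] {q : X → B}

/-- The map `X × ℝ → E` given by a family `s x ∈ E (q x)`. -/
def frameMap (s : ∀ x, E (q x)) (z : X × ℝ) : TotalSpace ℝ E := ⟨q z.1, z.2 • s z.1⟩

theorem trivializationAt_smul {b₀ b : B} (hb : b ∈ (trivializationAt ℝ E b₀).baseSet) (t : ℝ)
    (v : E b) : trivializationAt ℝ E b₀ ⟨b, t • v⟩ = (b, t * (trivializationAt ℝ E b₀ ⟨b, v⟩).2) :=
  Prod.ext ((trivializationAt ℝ E b₀).coe_fst' hb)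
    (((trivializationAt ℝ E b₀).linear ℝ hb).map_smul t v)

theorem trivializationAt_ne_zero {b₀ b : B} (hb : b ∈ (trivializationAt ℝ E b₀).baseSet)
    {v : E b} (hv : v ≠ 0) : (trivializationAt ℝ E b₀ ⟨b, v⟩).2 ≠ 0 := fun h =>
  hv (((trivializationAt ℝ E b₀).linearEquivAt ℝ b hb).map_eq_zero_iff.1 h)

omit [∀ b, AddCommMonoid (E b)] [∀ b, Module ℝ (E b)] [VectorBundle ℝ ℝ E] in
theorem continuousAt_trivializationAt_snd {s : ∀ x, E (q x)}
    (hs : Continuous fun x => (⟨q x, s x⟩ : TotalSpace ℝ E)) (x₀ : X) :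
    ContinuousAt (fun x => (trivializationAt ℝ E (q x₀) ⟨q x, s x⟩).2) x₀ :=
  ((FiberBundle.continuousAt_totalSpace ℝ _).1 hs.continuousAt).2

theorem continuous_frameMap (hq : Continuous q) {s : ∀ x, E (q x)}
    (hs : Continuous fun x => (⟨q x, s x⟩ : TotalSpace ℝ E)) : Continuous (frameMap s) := by
  refine continuous_iff_continuousAt.2 fun z => (FiberBundle.continuousAt_totalSpace ℝ _).2
    ⟨(hq.comp continuous_fst).continuousAt, ?_⟩
  have h := (continuousAt_snd (p := z)).mul
    ((continuousAt_trivializationAt_snd hs z.1).comp (x := z) continuousAt_fst)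
  refine h.congr ?_
  have hU : ∀ᶠ w in 𝓝 z, q w.1 ∈ (trivializationAt ℝ E (q z.1)).baseSet :=
    (hq.comp continuous_fst).continuousAt
      ((trivializationAt ℝ E (q z.1)).open_baseSet.mem_nhds
        (FiberBundle.mem_baseSet_trivializationAt ℝ E (q z.1)))
  filter_upwards [hU] with w hw
  exact (congrArg Prod.snd (trivializationAt_smul hw w.2 (s w.1))).symm

/-- In a chart the map is `(x, t) ↦ (q x, t * c x)` with `c` nonvanishing. Undoing the rescaling of
the fibre coordinate leaves `q × id`, which is open. -/
theorem isOpenMap_frameMap (hq : IsOpenQuotientMap q) {s : ∀ x, E (q x)}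
    (hs : Continuous fun x => (⟨q x, s x⟩ : TotalSpace ℝ E)) (h0 : ∀ x, s x ≠ 0) :
    IsOpenMap (frameMap s) := by
  refine IsOpenMap.of_nhds_le ?_
  rintro ⟨x₀, t₀⟩ V hV
  rw [Filter.mem_map] at hV
  let e := trivializationAt ℝ E (q x₀)
  have hb₀ : q x₀ ∈ e.baseSet := FiberBundle.mem_baseSet_trivializationAt ℝ E (q x₀)
  let c : X → ℝ := fun x => (e ⟨q x, s x⟩).2
  have hc : ContinuousAt c x₀ := continuousAt_trivializationAt_snd hs x₀
  have hc0 : ∀ x, q x ∈ e.baseSet → c x ≠ 0 := fun x hx => trivializationAt_ne_zero hx (h0 x)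
  -- The inverse rescaling. Continuity is needed only at `z'`, the point that `ρ` sends to `(x₀,
  -- t₀)`.
  let ρ : X × ℝ → X × ℝ := fun z => (z.1, z.2 / c z.1)
  let z' : X × ℝ := (x₀, t₀ * c x₀)
  have hρz : ρ z' = (x₀, t₀) := Prod.ext rfl (mul_div_cancel_right₀ _ (hc0 x₀ hb₀))
  have hρ : ContinuousAt ρ z' := continuousAt_fst.prodMk
    (continuousAt_snd.div (ContinuousAt.comp (f := Prod.fst) (g := c) (x := z') hc continuousAt_fst) (hc0 x₀ hb₀))
  -- The set `V` seen in the chart. Injectivity of `e` on its source means that one preimage in `V`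
  -- suffices.
  let W : Set (B × ℝ) := {w | ∀ p ∈ e.source, e p = w → p ∈ V}
  have hW : (Prod.map q id) ⁻¹' W ∈ 𝓝 z' := by
    have h1 : ∀ᶠ z in 𝓝 z', ρ z ∈ frameMap s ⁻¹' V := hρ (by rw [hρz]; exact hV)
    have h2 : ∀ᶠ z in 𝓝 z', q z.1 ∈ e.baseSet :=
      (hq.continuous.comp continuous_fst).continuousAt (e.open_baseSet.mem_nhds hb₀)
    filter_upwards [h1, h2] with z hz hzU p hp hpe
    have h3 : e (frameMap s (ρ z)) = (q z.1, z.2) :=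
      (trivializationAt_smul hzU _ _).trans
        (Prod.ext rfl (div_mul_cancel₀ _ (hc0 z.1 hzU)))
    have h4 : p = frameMap s (ρ z) :=
      e.injOn hp (e.mem_source.2 hzU) (hpe.trans h3.symm)
    rw [h4]
    exact hz
  have hW' : W ∈ 𝓝 (e (frameMap s (x₀, t₀))) := by
    have h5 : e (frameMap s (x₀, t₀)) = Prod.map q id z' := trivializationAt_smul hb₀ _ _
    rw [h5]
    exact Filter.mem_of_superset
      ((hq.prodMap IsOpenQuotientMap.id).isOpenMap.image_mem_nhds hW) (image_preimage_subset _ _)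
  have hsrc : frameMap s (x₀, t₀) ∈ e.source := e.mem_source.2 hb₀
  filter_upwards [e.toOpenPartialHomeomorph.continuousAt hsrc hW', e.open_source.mem_nhds hsrc] with p hp hp'
  exact hp p hp' rfl

/-- A trivialization identifies the fibre with `ℝ`, where any nonzero element is a basis. -/
theorem exists_linearEquiv_smul {b : B} {v : E b} (hv : v ≠ 0) :
    ∃ Λ : ℝ ≃ₗ[ℝ] E b, ∀ t, Λ t = t • v := by
  let L := (trivializationAt ℝ E b).linearEquivAt ℝ b
    (FiberBundle.mem_baseSet_trivializationAt ℝ E b)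
  have hL : L v ≠ 0 := fun h => hv (L.map_eq_zero_iff.1 h)
  refine ⟨(LinearEquiv.smulOfNeZero ℝ ℝ (L v) hL).trans L.symm, fun t => ?_⟩
  rw [LinearEquiv.trans_apply, LinearEquiv.symm_apply_eq, map_smul]
  exact mul_comm _ _

omit [TopologicalSpace X] in
theorem surjective_frameMap (hq : Function.Surjective q) {s : ∀ x, E (q x)}
    (h0 : ∀ x, s x ≠ 0) : Function.Surjective (frameMap s) := by
  rintro ⟨b, v⟩
  obtain ⟨x, rfl⟩ := hq b
  obtain ⟨Λ, hΛ⟩ := exists_linearEquiv_smul (h0 x)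
  obtain ⟨t, rfl⟩ := Λ.surjective v
  exact ⟨(x, t), by rw [frameMap, hΛ]⟩

variable {E' : B → Type*}
  [∀ b, AddCommMonoid (E' b)] [∀ b, Module ℝ (E' b)] [TopologicalSpace (TotalSpace ℝ E')]
  [∀ b, TopologicalSpace (E' b)] [FiberBundle ℝ E'] [VectorBundle ℝ ℝ E']

/-- Line bundles whose pullbacks along an open quotient map have nowhere vanishing sections with
the same transformation law are isomorphic. -/
theorem LineBundleIso.of_frames (hq : IsOpenQuotientMap q) {s : ∀ x, E (q x)}
    {s' : ∀ x, E' (q x)}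
    (hs : Continuous fun x => (⟨q x, s x⟩ : TotalSpace ℝ E))
    (hs' : Continuous fun x => (⟨q x, s' x⟩ : TotalSpace ℝ E'))
    (h0 : ∀ x, s x ≠ 0) (h0' : ∀ x, s' x ≠ 0)
    (hrel : ∀ x y, q x = q y → ∃ u : ℝ,
      (⟨q y, s y⟩ : TotalSpace ℝ E) = ⟨q x, u • s x⟩ ∧
      (⟨q y, s' y⟩ : TotalSpace ℝ E') = ⟨q x, u • s' x⟩) : LineBundleIso E E' := by
  -- The isomorphism is built from one point `x` over `b`; the common factor `u` makes it match the
  -- frames at every other point over `b`.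
  have hθ : ∀ b, ∃ θ : E b ≃ₗ[ℝ] E' b, ∀ y (v : E b), (⟨b, v⟩ : TotalSpace ℝ E) = ⟨q y, s y⟩ →
      (⟨b, θ v⟩ : TotalSpace ℝ E') = ⟨q y, s' y⟩ := by
    intro b
    obtain ⟨x, rfl⟩ := hq.surjective b
    obtain ⟨Λ, hΛ⟩ := exists_linearEquiv_smul (h0 x)
    obtain ⟨Λ', hΛ'⟩ := exists_linearEquiv_smul (h0' x)
    refine ⟨Λ.symm.trans Λ', fun y v hv => ?_⟩
    obtain ⟨u, h1, h2⟩ := hrel x y (congrArg TotalSpace.proj hv)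
    rw [h2]
    obtain rfl : v = u • s x := TotalSpace.mk_injective _ (hv.trans h1)
    rw [← hΛ, LinearEquiv.trans_apply, LinearEquiv.symm_apply_apply, hΛ']
  choose θ hθ using hθ
  let Θ : TotalSpace ℝ E → TotalSpace ℝ E' := fun p => ⟨p.1, θ p.1 p.2⟩
  have hcomp : Θ ∘ frameMap s = frameMap s' := by
    funext z
    have h : θ (q z.1) (s z.1) = s' z.1 := TotalSpace.mk_injective _ (hθ (q z.1) z.1 _ rfl)
    change (⟨q z.1, θ (q z.1) (z.2 • s z.1)⟩ : TotalSpace ℝ E') = ⟨q z.1, z.2 • s' z.1⟩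
    rw [map_smul, h]
  have hc := continuous_frameMap hq.continuous hs
  have hsurj := surjective_frameMap hq.surjective h0
  refine ⟨θ, ?_, ?_, ?_, ?_⟩
  -- Both continuity and openness of `Θ` descend from `frameMap s'` along the quotient map `frameMap
  -- s`.
  · have hquot : IsQuotientMap (frameMap s) := (isOpenMap_frameMap hq hs h0).isQuotientMap hc hsurj
    rw [hquot.continuous_iff]
    exact hcomp ▸ continuous_frameMap hq.continuous hs'
  · refine IsOpenMap.of_comp hc hsurj ?_
    exact hcomp ▸ isOpenMap_frameMap hq hs' h0'
  · rintro ⟨b, v⟩ ⟨b', v'⟩ h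
    obtain rfl : b = b' := congrArg TotalSpace.proj h
    exact congrArg _ ((θ b).injective (TotalSpace.mk_injective _ h))
  · rintro ⟨b, v⟩
    exact ⟨⟨b, (θ b).symm v⟩, congrArg (TotalSpace.mk b) ((θ b).apply_symm_apply v)⟩

/-- The tensor trivialization multiplies the coordinates of the factors, and `ℝ` has no zero
divisors. -/
theorem LineTensor.tmul_ne_zero {b : B} {v : E b} {w : E' b} (hv : v ≠ 0) (hw : w ≠ 0) :
    LineTensor.tmul v w ≠ 0 := by
  intro h
  have hb := FiberBundle.mem_baseSet_trivializationAt ℝ E b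
  have hb' := FiberBundle.mem_baseSet_trivializationAt ℝ E' b
  have h1 : tensorFwd (trivializationAt ℝ E b) (trivializationAt ℝ E' b) b
    (LineTensor.tmul v w) = 0 := by rw [h, map_zero]
  rw [LineTensor.tmul, tensorFwd_tmul, Trivialization.coe_linearMapAt_of_mem _ hb,
    Trivialization.coe_linearMapAt_of_mem _ hb'] at h1
  exact mul_ne_zero (trivializationAt_ne_zero hb hv) (trivializationAt_ne_zero hb' hw) h1

theorem LineTensor.continuous_tmul (hq : Continuous q) {s : ∀ x, E (q x)} {s' : ∀ x, E' (q x)}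
    (hs : Continuous fun x => (⟨q x, s x⟩ : TotalSpace ℝ E))
    (hs' : Continuous fun x => (⟨q x, s' x⟩ : TotalSpace ℝ E')) :
    Continuous fun x => (⟨q x, LineTensor.tmul (s x) (s' x)⟩ : TotalSpace ℝ (LineTensor E E')) := by
  refine continuous_iff_continuousAt.2 fun x₀ => (FiberBundle.continuousAt_totalSpace ℝ _).2
    ⟨hq.continuousAt, ?_⟩
  have h := (continuousAt_trivializationAt_snd hs x₀).mul (continuousAt_trivializationAt_snd hs' x₀)
  refine h.congr ?_
  have hU := hq.continuousAt ((trivializationAt ℝ E (q x₀)).open_baseSet.mem_nhds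
    (FiberBundle.mem_baseSet_trivializationAt ℝ E (q x₀)))
  have hU' := hq.continuousAt ((trivializationAt ℝ E' (q x₀)).open_baseSet.mem_nhds
    (FiberBundle.mem_baseSet_trivializationAt ℝ E' (q x₀)))
  filter_upwards [hU, hU'] with x hx hx'
  change (trivializationAt ℝ E (q x₀) ⟨q x, s x⟩).2 * (trivializationAt ℝ E' (q x₀) ⟨q x, s' x⟩).2 =
    tensorFwd (trivializationAt ℝ E (q x₀)) (trivializationAt ℝ E' (q x₀)) (q x)
    (s x ⊗ₜ[ℝ] s' x)
  rw [tensorFwd_tmul, Trivialization.coe_linearMapAt_of_mem _ hx,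
    Trivialization.coe_linearMapAt_of_mem _ hx']


variable {E₀ : B → Type*}
  [∀ b, AddCommMonoid (E₀ b)] [∀ b, Module ℝ (E₀ b)] [TopologicalSpace (TotalSpace ℝ E₀)]
  [∀ b, TopologicalSpace (E₀ b)] [FiberBundle ℝ E₀] [VectorBundle ℝ ℝ E₀]

/-- A line bundle with a frame over an open quotient of the base whose transformation law is the
product of those of frames of `E` and `E'` is isomorphic to the tensor product. -/
theorem LineBundleIso.lineTensor_of_frames (hq : IsOpenQuotientMap q) {s₀ : ∀ x, E₀ (q x)}
    {s : ∀ x, E (q x)} {s' : ∀ x, E' (q x)}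
    (hs₀ : Continuous fun x => (⟨q x, s₀ x⟩ : TotalSpace ℝ E₀))
    (hs : Continuous fun x => (⟨q x, s x⟩ : TotalSpace ℝ E))
    (hs' : Continuous fun x => (⟨q x, s' x⟩ : TotalSpace ℝ E'))
    (h0₀ : ∀ x, s₀ x ≠ 0) (h0 : ∀ x, s x ≠ 0) (h0' : ∀ x, s' x ≠ 0)
    (hrel : ∀ x y, q x = q y → ∃ u v : ℝ,
      (⟨q y, s₀ y⟩ : TotalSpace ℝ E₀) = ⟨q x, (u * v) • s₀ x⟩ ∧
      (⟨q y, s y⟩ : TotalSpace ℝ E) = ⟨q x, u • s x⟩ ∧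
      (⟨q y, s' y⟩ : TotalSpace ℝ E') = ⟨q x, v • s' x⟩) :
    LineBundleIso E₀ (LineTensor E E') := by
  refine LineBundleIso.of_frames hq hs₀ (LineTensor.continuous_tmul hq.continuous hs hs') h0₀
    (fun x => LineTensor.tmul_ne_zero (h0 x) (h0' x)) fun x y h => ?_
  obtain ⟨u, v, h₀, h1, h2⟩ := hrel x y h
  exact ⟨u * v, h₀, LineTensor.mk_tmul_smul h1 h2⟩

end Frames

/-! ### Frames of pulled-back tautological bundles -/

section TautologicalSections

variable {V : Type*} [AddCommGroup V] [Module ℝ V] {S : Set V} [InvolutiveNeg S] [AntipodalIn S]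

/-- A point `x` of `S` as a vector in the line over `[x]`. -/
def tautVec {b : AntipodalQuotient S} (x : S) (h : b = AntipodalQuotient.mk x) : Taut S b :=
  ⟨x, by subst h; exact Submodule.mem_span_singleton_self (x : V)⟩

theorem tautVec_ne_zero {b : AntipodalQuotient S} (x : S) (h : b = AntipodalQuotient.mk x) :
    tautVec x h ≠ 0 := fun h0 =>
  AntipodalIn.coe_ne_zero x (congrArg (tautIncl S b) h0)

/-- Turns a sign relation between ambient vectors into the transformation law of a frame. -/
theorem pullback_tautVec_smul {B : Type*} {f : B → AntipodalQuotient S} {b b' : B} {x x' : S}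
    {h : f b = AntipodalQuotient.mk x} {h' : f b' = AntipodalQuotient.mk x'} (hb : b = b') {u : ℝ}
    (hu : (x : V) = u • (x' : V)) :
    (⟨b, tautVec x h⟩ : TotalSpace ℝ (f *ᵖ (Taut S))) =
      ⟨b', (u • tautVec x' h' : Taut S (f b'))⟩ := by
  subst hb
  exact congrArg (TotalSpace.mk b) (Subtype.ext hu)

variable [TopologicalSpace V]

/-- The topologies are induced, first from the base times the tautological total space and then from
`(S / ±1) × V`, so only the base point and the ambient vector have to vary continuously. -/
theorem continuous_pullback_tautVec {B X : Type*} [TopologicalSpace B] [TopologicalSpace X]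
    {f : B → AntipodalQuotient S} (hf : Continuous f) {q : X → B} (hq : Continuous q) {a : X → S}
    (ha : Continuous a) (h : ∀ x, f (q x) = AntipodalQuotient.mk (a x)) :
    Continuous fun x => (⟨q x, tautVec (a x) (h x)⟩ : TotalSpace ℝ (f *ᵖ (Taut S))) := by
  rw [(inducing_pullbackTotalSpaceEmbedding ℝ (Taut S) f).continuous_iff]
  refine hq.prodMk ((isInducing_taut S).continuous_iff.2 ?_)
  exact (hf.comp hq).prodMk (continuous_subtype_val.comp ha)

end TautologicalSections
/-! ### Homotopies of maps to `RP^∞` -/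

/-- The point of `S^∞` on the ray of a nonzero vector. -/
def InfSphere.normalize (f : RInf) (hf : f ≠ 0) : InfSphere :=
  ⟨(√(RInf.normSq f))⁻¹ • f, by
    have h := RInf.normSq_pos hf
    change RInf.normSq _ = 1
    rw [RInf.normSq_smul, inv_pow, Real.sq_sqrt h.le, inv_mul_cancel₀ h.ne']⟩

theorem InfSphere.normalize_neg (f : RInf) (hf : f ≠ 0) (hf' : -f ≠ 0) :
    InfSphere.normalize (-f) hf' = -InfSphere.normalize f hf :=
  Subtype.ext (by
    change (√(RInf.normSq (-f)))⁻¹ • (-f) = -((√(RInf.normSq f))⁻¹ • f)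
    rw [RInf.normSq_neg, smul_neg])

theorem InfSphere.normalize_eq {f : RInf} (hf : f ≠ 0) {g : InfSphere} (h : f = g) :
    InfSphere.normalize f hf = g := by
  refine Subtype.ext ?_
  have h1 : RInf.normSq g.1 = 1 := g.2
  change (√(RInf.normSq f))⁻¹ • f = g.1
  rw [h, h1, Real.sqrt_one, inv_one, one_smul]

/-- Maps to `RP^∞` covered by maps to `S^∞` with the same transformation law are homotopic if the
segments between the values of the latter avoid the origin. -/
theorem homotopic_of_segment {B X : Type*} [TopologicalSpace B] [TopologicalSpace X] {q : X → B}
    (hq : IsOpenQuotientMap q) {F₀ F₁ : X → InfSphere} (hF₀ : Continuous F₀) (hF₁ : Continuous F₁)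
    {φ₀ φ₁ : C(B, RPInf)} (h₀ : ∀ x, φ₀ (q x) = AntipodalQuotient.mk (F₀ x))
    (h₁ : ∀ x, φ₁ (q x) = AntipodalQuotient.mk (F₁ x))
    (hrel : ∀ x y, q x = q y → ∃ u : ℤˣ, F₀ y = u • F₀ x ∧ F₁ y = u • F₁ x)
    (hne : ∀ (t : ℝ) x, 0 ≤ t → t ≤ 1 → (1 - t) • (F₀ x).1 + t • (F₁ x).1 ≠ 0) :
    φ₀.Homotopic φ₁ := by
  let H : unitInterval × X → RInf := fun z =>
    (1 - (z.1 : ℝ)) • (F₀ z.2).1 + (z.1 : ℝ) • (F₁ z.2).1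
  have hH0 : ∀ z, H z ≠ 0 := fun z => hne z.1 z.2 z.1.2.1 z.1.2.2
  have hI : Continuous fun z : unitInterval × X => (z.1 : ℝ) :=
    continuous_subtype_val.comp continuous_fst
  have hH : Continuous H :=
    ((continuous_const.sub hI).smul (continuous_subtype_val.comp (hF₀.comp continuous_snd))).add
      (hI.smul (continuous_subtype_val.comp (hF₁.comp continuous_snd)))
  have hN : Continuous fun z => InfSphere.normalize (H z) (hH0 z) := by
    refine Continuous.subtype_mk (Continuous.smul (Continuous.inv₀
      (Real.continuous_sqrt.comp (RInf.continuous_normSq.comp hH)) fun z => ?_) hH) _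
    exact (Real.sqrt_pos.2 (RInf.normSq_pos (hH0 z))).ne'
  let K : C(unitInterval × X, RPInf) :=
    ⟨fun z => AntipodalQuotient.mk (InfSphere.normalize (H z) (hH0 z)),
      AntipodalQuotient.isOpenQuotientMap_mk.continuous.comp hN⟩
  let Q : C(unitInterval × X, unitInterval × B) :=
    ⟨Prod.map id q, continuous_id.prodMap hq.continuous⟩
  -- Openness of `q` matters here: the product of a general quotient map with the identity need not
  -- be a quotient map.
  have hQ : IsQuotientMap Q := (IsOpenQuotientMap.id.prodMap hq).isQuotientMap
  have hK : Function.FactorsThrough K Q := by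
    rintro ⟨t, x⟩ ⟨t', y⟩ h
    obtain rfl : t = t' := congrArg Prod.fst h
    obtain ⟨u, h2, h3⟩ := hrel x y (congrArg Prod.snd h)
    -- Both endpoints change by the same sign, hence so does the whole segment, and its class in
    -- `RP^∞` is unchanged.
    refine AntipodalQuotient.mk_eq_mk.2 ?_
    rcases Int.units_eq_one_or u with rfl | rfl
    · left
      rw [one_smul] at h2 h3
      simp only [H, h2, h3]
    · right
      rw [InfSphere.neg_one_smul] at h2 h3
      have h4 : H (t, y) = -H (t, x) := by
        simp only [H, h2, h3, InfSphere.coe_neg, smul_neg, neg_add]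
      simp only [h4]
      exact InfSphere.normalize_neg _ _ _
  have hlift : ∀ t x, hQ.lift K hK (t, q x) = K (t, x) := fun t x =>
    DFunLike.congr_fun (hQ.lift_comp K hK) (t, x)
  refine ⟨⟨hQ.lift K hK, fun b => ?_, fun b => ?_⟩⟩
  · obtain ⟨x, rfl⟩ := hq.surjective b
    change hQ.lift K hK (0, q x) = _
    rw [hlift, h₀]
    refine congrArg AntipodalQuotient.mk (InfSphere.normalize_eq _ ?_)
    simp [H]
  · obtain ⟨x, rfl⟩ := hq.surjective b
    change hQ.lift K hK (1, q x) = _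
    rw [hlift, h₁]
    refine congrArg AntipodalQuotient.mk (InfSphere.normalize_eq _ ?_)
    simp [H]

/-- The basis vector `X ^ n`, as a point of `S^∞`. -/
def InfSphere.xPow (n : ℕ) : InfSphere :=
  InfSphere.normalize (X ^ n) (pow_ne_zero n X_ne_zero)

theorem exists_sphereMul_xPow (n : ℕ) (f : InfSphere) :
    ∃ c : ℝ, 0 < c ∧ (sphereMul (InfSphere.xPow n) f).1 = c • (X ^ n * f.1) := by
  have h1 : 0 < √(RInf.normSq (X ^ n)) :=
    Real.sqrt_pos.2 (RInf.normSq_pos (pow_ne_zero n X_ne_zero))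
  have h2 : 0 < √(RInf.normSq ((InfSphere.xPow n).1 * f.1)) :=
    Real.sqrt_pos.2 (RInf.normSq_pos
      (mul_ne_zero (InfSphere.ne_zero (InfSphere.xPow n)) (InfSphere.ne_zero f)))
  refine ⟨(√(RInf.normSq ((InfSphere.xPow n).1 * f.1)))⁻¹ * (√(RInf.normSq (X ^ n)))⁻¹,
    by positivity, ?_⟩
  change (√(RInf.normSq ((InfSphere.xPow n).1 * f.1)))⁻¹ •
    (((√(RInf.normSq (X ^ n)))⁻¹ • (X ^ n : RInf)) * f.1) = _
  rw [smul_mul_assoc, smul_smul]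

/-- The combination is `((1 - t) + t c Xⁿ) f` with `c > 0`. For `n ≠ 0` the coefficients `1 - t` and
`t c` sit in different degrees and cannot both vanish; polynomials have no zero divisors. -/
theorem segment_sphereMul_xPow_ne_zero {n : ℕ} (hn : n ≠ 0) (f : InfSphere) (t : ℝ) :
    (1 - t) • f.1 + t • (sphereMul (InfSphere.xPow n) f).1 ≠ 0 := by
  obtain ⟨c, hc, h⟩ := exists_sphereMul_xPow n f
  have h1 : (1 - t) • f.1 + t • (sphereMul (InfSphere.xPow n) f).1 =
      (C (1 - t) + C (t * c) * X ^ n) * f.1 := by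
    rw [h, smul_smul, smul_eq_C_mul, smul_eq_C_mul]
    ring
  rw [h1]
  refine mul_ne_zero (fun h2 => ?_) (InfSphere.ne_zero f)
  have h3 : (C (1 - t) + C (t * c) * X ^ n : RInf).coeff 0 = 0 := by rw [h2, coeff_zero]
  have h4 : (C (1 - t) + C (t * c) * X ^ n : RInf).coeff n = 0 := by rw [h2, coeff_zero]
  rw [coeff_add, coeff_C, if_pos rfl, coeff_C_mul, coeff_X_pow, if_neg hn.symm, mul_zero,
    add_zero] at h3
  rw [coeff_add, coeff_C, if_neg hn, coeff_C_mul, coeff_X_pow, if_pos rfl, mul_one,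
    zero_add] at h4
  rcases mul_eq_zero.1 h4 with h4 | h4
  · linarith
  · exact hc.ne' h4

/-- The two endpoints have disjoint supports: multiples of `Xⁿ` begin in degree `n`, while `g` ends
before it. -/
theorem segment_sphereMul_xPow_ne_zero_of_bounded {n : ℕ} (f g : InfSphere)
    (hg : ∀ k, n ≤ k → g.1.coeff k = 0) (t : ℝ) :
    (1 - t) • (sphereMul (InfSphere.xPow n) f).1 + t • g.1 ≠ 0 := by
  intro h0
  obtain ⟨c, hc, h⟩ := exists_sphereMul_xPow n f
  rw [h] at h0
  have h1 : t • g.1 = 0 := by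
    ext k
    rcases le_or_gt n k with hk | hk
    · rw [coeff_smul, hg k hk, smul_zero, coeff_zero]
    · have h2 := congrArg (fun p => p.coeff k) h0
      simpa [coeff_X_pow_mul', hk.not_ge] using h2
  have ht : t = 0 := (smul_eq_zero.1 h1).resolve_right (InfSphere.ne_zero g)
  rw [ht, sub_zero, one_smul, zero_smul, add_zero] at h0
  exact smul_ne_zero hc.ne' (mul_ne_zero (pow_ne_zero n X_ne_zero) (InfSphere.ne_zero f)) h0

theorem coeff_sphereMul_sphereInclusion {m : ℕ} (x y : RealSphere m) {k : ℕ}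
    (hk : 2 * m + 1 ≤ k) :
    (sphereMul (sphereInclusion m x) (sphereInclusion m y)).1.coeff k = 0 := by
  change ((√(RInf.normSq _))⁻¹ • (RInf.ofVec (m + 1) (fun i => x.1 i) *
    RInf.ofVec (m + 1) fun i => y.1 i)).coeff k = 0
  rw [coeff_smul, coeff_mul, Finset.sum_eq_zero, smul_zero]
  intro p hp
  have hp := Finset.HasAntidiagonal.mem_antidiagonal.1 hp
  rcases le_or_gt (m + 1) p.1 with h | h
  · rw [RInf.coeff_ofVec, dif_neg h.not_gt, zero_mul]
  · rw [RInf.coeff_ofVec _ p.2, dif_neg (by omega), mul_zero]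

theorem sphereMul_smul_right (u : ℤˣ) (f g : InfSphere) :
    sphereMul f (u • g) = u • sphereMul f g := by
  rcases Int.units_eq_one_or u with rfl | rfl
  · simp only [one_smul]
  · rw [InfSphere.neg_one_smul, InfSphere.neg_one_smul, sphereMul_neg_right]

theorem hopfMul_mk (f g : InfSphere) : hopfMul (AntipodalQuotient.mk f, AntipodalQuotient.mk g) =
    AntipodalQuotient.mk (sphereMul f g) := rfl

/-- Two maps to `RP^∞` covered by maps to `S^∞` with the same transformation law are homotopic
if one of the latter has bounded degree. -/
theorem homotopic_of_bounded {B X : Type*} [TopologicalSpace B] [TopologicalSpace X] {q : X → B}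
    (hq : IsOpenQuotientMap q) {F₀ F₁ : X → InfSphere} (hF₀ : Continuous F₀) (hF₁ : Continuous F₁)
    {φ₀ φ₁ : C(B, RPInf)} (h₀ : ∀ x, φ₀ (q x) = AntipodalQuotient.mk (F₀ x))
    (h₁ : ∀ x, φ₁ (q x) = AntipodalQuotient.mk (F₁ x))
    (hrel : ∀ x y, q x = q y → ∃ u : ℤˣ, F₀ y = u • F₀ x ∧ F₁ y = u • F₁ x)
    {n : ℕ} (hn : n ≠ 0) (hb : ∀ x k, n ≤ k → (F₁ x).1.coeff k = 0) : φ₀.Homotopic φ₁ := by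
  -- The intermediate map, Hopf multiplication of `φ₀` by the class of `Xⁿ`; multiplying by a fixed
  -- vector preserves the sign law.
  let φ : C(B, RPInf) :=
    hopfMul.comp ((ContinuousMap.const B (AntipodalQuotient.mk (InfSphere.xPow n))).prodMk φ₀)
  have hF : Continuous fun x => sphereMul (InfSphere.xPow n) (F₀ x) :=
    Continuous.comp (f := fun x => (InfSphere.xPow n, F₀ x)) continuous_sphereMul
      (continuous_const.prodMk hF₀)
  have hφ : ∀ x, φ (q x) = AntipodalQuotient.mk (sphereMul (InfSphere.xPow n) (F₀ x)) := fun x => by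
    change hopfMul (AntipodalQuotient.mk (InfSphere.xPow n), φ₀ (q x)) = _
    rw [h₀, hopfMul_mk]
  refine (homotopic_of_segment (φ₁ := φ) hq hF₀ hF h₀ hφ (fun x y hxy => ?_) fun t x _ _ =>
    segment_sphereMul_xPow_ne_zero hn (F₀ x) t).trans
    (homotopic_of_segment hq hF hF₁ hφ h₁ (fun x y hxy => ?_) fun t x _ _ =>
      segment_sphereMul_xPow_ne_zero_of_bounded (F₀ x) (F₁ x) (hb x) t)
  · obtain ⟨u, hu, -⟩ := hrel x y hxy
    exact ⟨u, hu, by rw [hu, sphereMul_smul_right]⟩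
  · obtain ⟨u, hu, hu'⟩ := hrel x y hxy
    exact ⟨u, by rw [hu, sphereMul_smul_right], hu'⟩
/-! ### Arbitrary classifying maps -/

theorem RealSphere.coe_units_smul {m : ℕ} (u : ℤˣ) (x : RealSphere m) :
    ((u • x : RealSphere m) : EuclideanSpace ℝ (Fin (m + 1))) = ((u : ℤ) : ℝ) • x.1 := by
  rcases Int.units_eq_one_or u with rfl | rfl
  · simp
  · rw [RealSphere.neg_one_smul]
    simp

theorem InfSphere.coe_units_smul (u : ℤˣ) (f : InfSphere) :
    ((u • f : InfSphere) : RInf) = ((u : ℤ) : ℝ) • f.1 := by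
  rcases Int.units_eq_one_or u with rfl | rfl
  · simp
  · rw [InfSphere.neg_one_smul, InfSphere.coe_neg]
    simp

/-- A flip `g` gives `(u, v) = (gᵢ, 1)`; followed by the antipode it gives `(-gᵢ, -1)`. The product
is `gᵢ` in both cases, in accordance with `F` being defined on the antipodal quotient. -/
theorem exists_units_of_equivariant {m s : ℕ} (hs : 2 ≤ s)
    {F : ProjProd m s → Fin (s - 1) → InfSphere}
    (hF : ∀ (g : SignGroup s) p, F (g • p) = g • F p) (i : Fin (s - 1))
    {x y : Fin s → RealSphere m} (h : spherePowProj m s x = spherePowProj m s y) :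
    ∃ u v : ℤˣ, y i.initOf = u • x i.initOf ∧ y (Fin.lastOf hs) = v • x (Fin.lastOf hs) ∧
      F (AntipodalQuotient.mk y) i = (u * v) • F (AntipodalQuotient.mk x) i := by
  obtain ⟨g, rfl | rfl⟩ := exists_flipSigns hs h
  · refine ⟨g i, 1, flipSigns_initOf g x i, ?_, ?_⟩
    · rw [flipSigns_lastOf, one_smul]
    · rw [mul_one, ← smul_mk, hF]
      rfl
  · refine ⟨-g i, -1, ?_, ?_, ?_⟩
    · rw [Pi.neg_apply, flipSigns_initOf, ← RealSphere.neg_one_smul, smul_smul, neg_one_mul]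
    · rw [Pi.neg_apply, flipSigns_lastOf, RealSphere.neg_one_smul]
    · rw [neg_mul_neg, mul_one, AntipodalQuotient.mk_neg, ← smul_mk, hF]
      rfl

/-- All that is retained of the isomorphism with the pullback is its component in `E`. -/
theorem ClassifiesPrincipal.exists_equivariant {G P B E BG : Type*} [Group G] [TopologicalSpace P]
    [TopologicalSpace B] [TopologicalSpace E] [TopologicalSpace BG] [MulAction G P] [MulAction G E]
    {q : C(E, BG)} {f : C(B, BG)} {proj : C(P, B)} (h : ClassifiesPrincipal G q f proj) :
    ∃ F : C(P, E), (∀ p, f (proj p) = q (F p)) ∧ ∀ (g : G) p, F (g • p) = g • F p := by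
  obtain ⟨Φ, h1, h2⟩ := h
  refine ⟨⟨fun p => (Φ p).1.2,
    continuous_snd.comp (continuous_subtype_val.comp Φ.continuous)⟩, fun p => ?_, h2⟩
  rw [← h1]
  exact (Φ p).2

theorem classifiesLineBundle_of_equivariant {m s : ℕ} (hs : 2 ≤ s)
    {μ : C(Fin s → RP m, Fin (s - 1) → RPInf)} (F : C(ProjProd m s, Fin (s - 1) → InfSphere))
    (hμ : ∀ p, μ (piProj m s p) = univProj (s - 1) (F p))
    (hF : ∀ (g : SignGroup s) p, F (g • p) = g • F p) (i : Fin (s - 1)) :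
    ClassifiesLineBundle ((coordProj i).comp μ)
      (LineTensor (coordProj i.initOf *ᵖ (hopfBundle m))
        (coordProj (Fin.lastOf hs) *ᵖ (hopfBundle m))) := by
  have hq := isOpenQuotientMap_spherePowProj m s
  have hFi : Continuous fun x : Fin s → RealSphere m => F (AntipodalQuotient.mk x) i :=
    (continuous_apply i).comp
      (F.continuous.comp AntipodalQuotient.isOpenQuotientMap_mk.continuous)
  have hμi : ∀ x, ((coordProj i).comp μ) (spherePowProj m s x) =
      AntipodalQuotient.mk (F (AntipodalQuotient.mk x) i) := fun x => congrFun (hμ (AntipodalQuotient.mk x)) i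
  have hc : ∀ j : Fin s, Continuous fun x : Fin s → RealSphere m =>
      (⟨spherePowProj m s x, tautVec (x j) rfl⟩ :
        TotalSpace ℝ ((coordProj j : C(Fin s → RP m, RP m)) *ᵖ (hopfBundle m))) := fun j =>
    continuous_pullback_tautVec (coordProj j : C(Fin s → RP m, RP m)).continuous hq.continuous
      (continuous_apply j) fun _ => rfl
  -- The frames are `Fᵢ(x)`, `xᵢ` and `xₛ`, with respective factors `uv`, `u` and `v`.
  refine LineBundleIso.lineTensor_of_frames hq
    (s₀ := fun x => (tautVec (F (AntipodalQuotient.mk x) i) (hμi x) :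
      univLine (((coordProj i).comp μ) (spherePowProj m s x))))
    (s := fun x => (tautVec (x i.initOf) rfl :
      hopfBundle m (coordProj i.initOf (spherePowProj m s x))))
    (s' := fun x => (tautVec (x (Fin.lastOf hs)) rfl :
      hopfBundle m (coordProj (Fin.lastOf hs) (spherePowProj m s x))))
    (continuous_pullback_tautVec ((coordProj i).comp μ).continuous hq.continuous hFi hμi)
    (hc i.initOf) (hc (Fin.lastOf hs)) (fun x => tautVec_ne_zero _ _)
    (fun x => tautVec_ne_zero _ _) (fun x => tautVec_ne_zero _ _) fun x y h => ?_
  obtain ⟨u, v, hu, hv, huv⟩ := exists_units_of_equivariant hs hF i h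
  refine ⟨((u : ℤ) : ℝ), ((v : ℤ) : ℝ), pullback_tautVec_smul h.symm ?_,
    pullback_tautVec_smul h.symm (by rw [hu, RealSphere.coe_units_smul]),
    pullback_tautVec_smul h.symm (by rw [hv, RealSphere.coe_units_smul])⟩
  rw [huv, InfSphere.coe_units_smul]
  push_cast
  rfl

theorem homotopic_hopfComponent_of_equivariant {m s : ℕ} (hs : 2 ≤ s)
    {μ : C(Fin s → RP m, Fin (s - 1) → RPInf)} (F : C(ProjProd m s, Fin (s - 1) → InfSphere))
    (hμ : ∀ p, μ (piProj m s p) = univProj (s - 1) (F p))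
    (hF : ∀ (g : SignGroup s) p, F (g • p) = g • F p) (i : Fin (s - 1)) :
    ((coordProj i).comp μ).Homotopic (hopfComponent m s hs i) := by
  have hmk := (AntipodalQuotient.isOpenQuotientMap_mk (X := Fin s → RealSphere m)).continuous
  have hc : ∀ F : C(ProjProd m s, Fin (s - 1) → InfSphere),
      Continuous fun x : Fin s → RealSphere m => F (AntipodalQuotient.mk x) i := fun F =>
    (continuous_apply i).comp (F.continuous.comp hmk)
  refine homotopic_of_bounded (isOpenQuotientMap_spherePowProj m s) (hc F)
    (hc (hopfLift m s hs)) (fun x => congrFun (hμ (AntipodalQuotient.mk x)) i) (fun x => rfl)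
    (fun x y h => ?_)
    -- Points of `S^m` are polynomials of degree at most `m`, so their products have degree at most
    -- `2m`.
    (n := 2 * m + 1) (by omega) fun x k hk => coeff_sphereMul_sphereInclusion _ _ hk
  obtain ⟨u, v, hu, hv, huv⟩ := exists_units_of_equivariant hs hF i h
  refine ⟨u * v, huv, ?_⟩
  change sphereMul (sphereInclusion m (y i.initOf)) (sphereInclusion m (y (Fin.lastOf hs))) =
    (u * v) • sphereMul (sphereInclusion m (x i.initOf)) (sphereInclusion m (x (Fin.lastOf hs)))
  rw [hu, hv, sphereInclusion_smul, sphereInclusion_smul, sphereMul_smul_left,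
    sphereMul_smul_right, smul_smul]
end

theorem proposition2p2 (m s : ℕ) (hm : 1 ≤ m) (hs : 2 ≤ s) :
    IsPrincipalBundle (SignGroup s) (piProj m s) ∧
    (∃ μ : C(Fin s → RP m, Fin (s - 1) → RPInf),
      ClassifiesPrincipal (SignGroup s) (univProj (s - 1)) μ (piProj m s)) ∧
    ∀ μ : C(Fin s → RP m, Fin (s - 1) → RPInf),
      ClassifiesPrincipal (SignGroup s) (univProj (s - 1)) μ (piProj m s) →
      ∀ i : Fin (s - 1),
        ClassifiesLineBundle ((coordProj i).comp μ)
          (LineTensor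
            (coordProj (⟨i, by omega⟩ : Fin s) *ᵖ (hopfBundle m))
            (coordProj (⟨s - 1, by omega⟩ : Fin s) *ᵖ (hopfBundle m))) ∧
        ((coordProj i).comp μ).Homotopic
          (hopfMul.comp (((rpInclusion m).prodMap (rpInclusion m)).comp
            ((coordProj (⟨i, by omega⟩ : Fin s)).prodMk
              (coordProj (⟨s - 1, by omega⟩ : Fin s))))) := by
  refine ⟨isPrincipalBundle_piProj m s hs, exists_classifiesPrincipal_piProj m s hs,
    fun μ h i => ?_⟩
  obtain ⟨F, hμ, hF⟩ := h.exists_equivariant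
  exact ⟨classifiesLineBundle_of_equivariant hs F hμ hF i,
    homotopic_hopfComponent_of_equivariant hs F hμ hF i⟩
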